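/- Let $K$ be a field of characteristic zero, let $n\ge 1$, and let $d_0,\dots,d_n$ be positive integers. Let $\mathbb A=K[x_0,\dots,x_n]$, graded by $\deg x_i=d_i$, and let $\mathbb D=K\langle x_0,\dots,x_n,\partial_0,\dots,\partial_n\rangle$ ($\partial_i=\partial/\partial x_i$) be the Weyl algebra, graded by $\deg x_i=d_i$, $\deg\partial_i=-d_i$. Let $E=\sum_i d_ix_i\partial_i\in\mathbb D_0$ and fix $\lambda\in K$. A left $\mathbb D$-module $M$ is called $\lambda$-Euler if $M=\bigoplus_{k\in\mathbb Z}M_k$, where $M_k=\{m\in M: Em=(\lambda+k)m\}$; it is called torsion if every $m\in M$ satisfies $\mathbb A_km=0$ for all sufficiently large $k$. Let $\mathbb D\text{-Gr}^\lambda$ be the category of $\lambda$-Euler $\mathbb D$-modules (a full subcategory of all $\mathbb D$-modules), let $\mathbb D\text{-Tors}^\lambda$ be its Serre subcategory of torsion modules, and define the category of $\lambda$-twisted D-modules on the weighted projective stack $[X]=[(K^{n+1}\setminus 0)/\mathbb G_m]$ as the quotient category $$\mathcal D^\lambda_{[X]}\text{-Qcoh}=\mathbb D\text{-Gr}^\lambda/\mathbb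 D\text{-Tors}^\lambda .$$ The quotient functor $\pi:\mathbb D\text{-Gr}^\lambda\to\mathcal D^\lambda_{[X]}\text{-Qcoh}$ has a right adjoint $\omega$. Since $E$ is central in $\mathbb D_0$, the degree zero part $(D^\lambda_{[X]})_0=\mathbb D_0/\mathbb D_0(E-\lambda)$ of $D^\lambda_{[X]}=\mathbb D/\mathbb D(E-\lambda)$ is an algebra, and it acts on $M_0$ for every $\lambda$-Euler module $M$. Let $$\Gamma_\lambda:\mathcal D^\lambda_{[X]}\text{-Qcoh}\to (D^\lambda_{[X]})_0\text{-Mod},\qquad \Gamma_\lambda(\mathcal M)=\omega(\mathcal M)_0 .$$ Let $\mathcal A\subset K$ be the set of all $\mathbb Z_{\ge0}$-linear combinations of $d_0,\dots,d_n$, and suppose $\lambda\notin -\sum_i d_i-\mathcal A$, that is, $\lambda\neq-\sum_i d_i-a$ for all $a\in\mathcal A$. **Theorem.** The functor $\Gamma_\lambda$ is exact. Moreover, $\Gamma_\lambda$ induces an equivalence between the quotient category $\mathcal D^\lambda_{[X]}\text{-Qcoh}/\operatorname{Ker}\Gamma_\lambda$ (where $\operatorname{Ker}\Gamma_\lambda$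 is the Serre subcategory of all $\mathcal M$ with $\Gamma_\lambda(\mathcal M)=0$) and $(D^\lambda_{[X]})_0\text{-Mod}$: there is an equivalence $F$ from this quotient category to $(D^\lambda_{[X]})_0\text{-Mod}$ with $F\circ Q\cong\Gamma_\lambda$, where $Q$ is the quotient functor. -/

import Mathlib

open CategoryTheory CategoryTheory.Limits

universe u

noncomputable section

namespace WPS

/-! ### The Weyl algebra -/

section Weyl

variable (K : Type u) [Field K] (n : ℕ)

/-- The polynomial ring `𝔸 = K[x₀, …, xₙ]`. -/
abbrev Poly : Type u := MvPolynomial (Fin (n + 1)) K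

/-- The Weyl algebra `𝔻 = K⟨x₀, …, xₙ, ∂₀, …, ∂ₙ⟩`, as the algebra of `K`-linear operators on
`K[x₀, …, xₙ]` generated by the multiplications by the `xᵢ` and the `∂ᵢ = ∂/∂xᵢ`. -/
def weylSubalgebra : Subalgebra K (Module.End K (Poly K n)) :=
  Algebra.adjoin K
    (Set.range (fun i => LinearMap.mulLeft K (MvPolynomial.X i : Poly K n)) ∪
      Set.range (fun i => ((MvPolynomial.pderiv i : Derivation K (Poly K n) (Poly K n)) :
        Poly K n →ₗ[K] Poly K n)))

/-- The Weyl algebra as a type. -/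
def Weyl : Type u := ↥(weylSubalgebra K n)

instance : Ring (Weyl K n) := inferInstanceAs (Ring ↥(weylSubalgebra K n))

instance : Algebra K (Weyl K n) := inferInstanceAs (Algebra K ↥(weylSubalgebra K n))

variable {K n}

/-- The operator on polynomials given by an element of the Weyl algebra. -/
def Weyl.op : Weyl K n →ₐ[K] Module.End K (Poly K n) := (weylSubalgebra K n).val

lemma Weyl.op_injective : Function.Injective (Weyl.op (K := K) (n := n)) :=
  Subtype.val_injective

lemma Weyl.ext' {v w : Weyl K n} (h : ∀ f, Weyl.op v f = Weyl.op w f) : v = w :=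
  Weyl.op_injective (LinearMap.ext h)

/-- The generator `∂ᵢ` of the Weyl algebra. -/
def Weyl.del (i : Fin (n + 1)) : Weyl K n :=
  ⟨((MvPolynomial.pderiv i : Derivation K (Poly K n) (Poly K n)) : Poly K n →ₗ[K] Poly K n),
    Algebra.subset_adjoin (Or.inr ⟨i, rfl⟩)⟩

lemma mulLeft_mem (p : Poly K n) : LinearMap.mulLeft K p ∈ weylSubalgebra K n := by
  have h : LinearMap.mulLeft K p = Algebra.lmul K (Poly K n) p := rfl
  rw [h]
  induction p using MvPolynomial.induction_on with
  | C a =>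
    rw [← MvPolynomial.algebraMap_eq, AlgHom.commutes]
    exact Subalgebra.algebraMap_mem _ _
  | add p q hp hq => rw [map_add]; exact add_mem (hp rfl) (hq rfl)
  | mul_X p i hp =>
    rw [map_mul]
    exact mul_mem (hp rfl) (Algebra.subset_adjoin (Or.inl ⟨i, rfl⟩))

/-- The inclusion of the polynomial ring `𝔸` in the Weyl algebra `𝔻`. -/
def polyToWeyl : Poly K n →ₐ[K] Weyl K n :=
  (Algebra.lmul K (Poly K n)).codRestrict (weylSubalgebra K n) mulLeft_mem

/-- The generator `xᵢ` of the Weyl algebra. -/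
def Weyl.x (i : Fin (n + 1)) : Weyl K n := polyToWeyl (MvPolynomial.X i)

@[simp]
lemma op_polyToWeyl (p f : Poly K n) : Weyl.op (polyToWeyl p) f = p * f := rfl

@[simp]
lemma op_x (i : Fin (n + 1)) (f : Poly K n) :
    Weyl.op (Weyl.x i : Weyl K n) f = MvPolynomial.X i * f := rfl

@[simp]
lemma op_del (i : Fin (n + 1)) (f : Poly K n) :
    Weyl.op (Weyl.del i : Weyl K n) f = MvPolynomial.pderiv i f := rfl

lemma Weyl.induction {p : Weyl K n → Prop} (w : Weyl K n)
    (hx : ∀ i, p (Weyl.x i)) (hd : ∀ i, p (Weyl.del i))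
    (hc : ∀ c : K, p (algebraMap K _ c))
    (hadd : ∀ v w, p v → p w → p (v + w)) (hmul : ∀ v w, p v → p w → p (v * w)) : p w := by
  obtain ⟨w, hw⟩ := w
  refine Algebra.adjoin_induction (p := fun w hw => p ⟨w, hw⟩) ?_ ?_ ?_ ?_ hw
  · rintro _ (⟨i, rfl⟩ | ⟨i, rfl⟩)
    · exact hx i
    · exact hd i
  · exact hc
  · intro v w hv hw h1 h2; exact hadd _ _ h1 h2
  · intro v w hv hw h1 h2; exact hmul _ _ h1 h2

lemma del_mul_poly (i : Fin (n + 1)) (p : Poly K n) :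
    Weyl.del i * polyToWeyl p
      = polyToWeyl p * Weyl.del i + polyToWeyl (MvPolynomial.pderiv i p) := by
  apply Weyl.ext'
  intro f
  simp only [map_mul, map_add, Module.End.mul_apply, LinearMap.add_apply, op_polyToWeyl, op_del,
    Derivation.leibniz, smul_eq_mul]
  ring

/-! ### The grading and the Euler field -/

variable (d : Fin (n + 1) → ℕ+)

variable (K) in
/-- `𝔸ₖ`: the polynomials of degree `k` for the grading with `deg xᵢ = dᵢ`. -/
def polyDegree (k : ℤ) : Submodule K (Poly K n) :=
  MvPolynomial.weightedHomogeneousSubmodule K (fun i => ((d i : ℕ) : ℤ)) k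

variable (K) in
/-- `𝔻ₖ`: the elements of degree `k` of the Weyl algebra, for the grading induced by that of
`𝔸` (for which `deg xᵢ = dᵢ` and `deg ∂ᵢ = -dᵢ`). -/
def weylDegree (k : ℤ) : Submodule K (Weyl K n) where
  carrier := {w | ∀ j : ℤ, ∀ f ∈ polyDegree K d j, Weyl.op w f ∈ polyDegree K d (j + k)}
  zero_mem' j f _ := by simp
  add_mem' hv hw j f hf := by
    rw [map_add]; exact add_mem (hv j f hf) (hw j f hf)
  smul_mem' c w hw j f hf := by
    rw [map_smul]; exact Submodule.smul_mem _ c (hw j f hf)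

variable (K) in
/-- The subalgebra `𝔻₀` of the Weyl algebra. -/
def weylZero : Subalgebra K (Weyl K n) where
  carrier := weylDegree K d 0
  mul_mem' {v w} hv hw j f hf := by
    have h := hv _ _ (hw j f hf)
    simpa [map_mul] using h
  add_mem' hv hw := (weylDegree K d 0).add_mem hv hw
  algebraMap_mem' c j f hf := by
    rw [AlgHom.commutes, add_zero]
    exact Submodule.smul_mem _ c hf

lemma x_mem_weylDegree (i : Fin (n + 1)) : (Weyl.x i : Weyl K n) ∈ weylDegree K d ((d i : ℕ) : ℤ) := by
  intro j f hf
  rw [op_x, add_comm j]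
  exact (MvPolynomial.isWeightedHomogeneous_X K (fun i => ((d i : ℕ) : ℤ)) i).mul hf

lemma del_mem_weylDegree (i : Fin (n + 1)) :
    (Weyl.del i : Weyl K n) ∈ weylDegree K d (-((d i : ℕ) : ℤ)) := by
  intro j f hf
  rw [op_del]
  exact (MvPolynomial.IsWeightedHomogeneous.pderiv (w := fun i => ((d i : ℕ) : ℤ)) hf (by simp))

variable (K) in
/-- The Euler field `E = ∑ᵢ dᵢ xᵢ ∂ᵢ`. -/
def euler : Weyl K n := ∑ i, ((d i : ℕ) : K) • (Weyl.x i * Weyl.del i)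

lemma op_euler {j : ℤ} {f : Poly K n} (hf : f ∈ polyDegree K d j) :
    Weyl.op (euler K d) f = (j : K) • f := by
  have key : ∀ m : Fin (n + 1) →₀ ℕ, ∀ c : K, Weyl.op (euler K d) (MvPolynomial.monomial m c) =
      ((Finsupp.weight (fun i => ((d i : ℕ) : ℤ)) m : ℤ) : K) • MvPolynomial.monomial m c := by
    intro m c
    have h1 : ∀ i, (MvPolynomial.X i : Poly K n) *
        MvPolynomial.pderiv i (MvPolynomial.monomial m c) =
        (m i : K) • MvPolynomial.monomial m c := by
      intro i
      rw [MvPolynomial.X_mul_pderiv_monomial]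
      rw [← Nat.cast_smul_eq_nsmul K]
    simp only [euler, map_sum, map_smul, map_mul, LinearMap.sum_apply, LinearMap.smul_apply,
      Module.End.mul_apply, op_x, op_del, h1, smul_smul, ← Finset.sum_smul]
    congr 1
    rw [Finsupp.weight_apply, Finsupp.sum_fintype _ _ (by simp)]
    push_cast
    exact Finset.sum_congr rfl fun i _ => by simp [mul_comm]
  have hf' : MvPolynomial.IsWeightedHomogeneous (fun i => ((d i : ℕ) : ℤ)) f j := hf
  conv_lhs => rw [f.as_sum]
  conv_rhs => rw [f.as_sum]
  rw [map_sum, Finset.smul_sum]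
  refine Finset.sum_congr rfl fun m hm => ?_
  rw [key, hf' (MvPolynomial.mem_support_iff.1 hm)]

lemma euler_mem_weylZero : euler K d ∈ weylZero K d := by
  intro j f hf
  rw [op_euler d hf, add_zero]
  exact Submodule.smul_mem _ _ hf

lemma monomial_mem_polyDegree (m : Fin (n + 1) →₀ ℕ) (c : K) :
    MvPolynomial.monomial m c ∈ polyDegree K d (Finsupp.weight (fun i => ((d i : ℕ) : ℤ)) m) :=
  MvPolynomial.isWeightedHomogeneous_monomial _ _ _ rfl

lemma euler_commute {w : Weyl K n} {k : ℤ} (hw : w ∈ weylDegree K d k) :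
    euler K d * w = w * euler K d + (k : K) • w := by
  apply Weyl.ext'
  intro f
  induction f using MvPolynomial.induction_on' with
  | add p q hp hq => rw [map_add, map_add, hp, hq]
  | monomial m c =>
    have h := monomial_mem_polyDegree (K := K) d m c
    simp only [map_mul, map_add, map_smul, LinearMap.add_apply, Module.End.mul_apply,
      LinearMap.smul_apply]
    rw [op_euler d h, op_euler d (hw _ _ h), map_smul, ← add_smul]
    push_cast
    rfl

lemma euler_commute_zero {w : Weyl K n} (hw : w ∈ weylZero K d) :
    euler K d * w = w * euler K d := by
  simpa using euler_commute d (k := 0) hw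

variable (K) in
/-- The Euler field as an element of `𝔻₀`. -/
def eulerZero : weylZero K d := ⟨euler K d, euler_mem_weylZero d⟩

/-- The left ideal `𝔻₀ (E - λ)` of `𝔻₀`. -/
def eulerIdeal (lam : K) : Ideal (weylZero K d) :=
  Ideal.span {eulerZero K d - algebraMap K _ lam}

instance (lam : K) : (eulerIdeal d lam).IsTwoSided := by
  constructor
  intro a b ha
  obtain ⟨c, rfl⟩ := Submodule.mem_span_singleton.1 ha
  refine Submodule.mem_span_singleton.2 ⟨c * b, ?_⟩
  have h : (eulerZero K d - algebraMap K _ lam) * b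
      = b * (eulerZero K d - algebraMap K _ lam) := by
    rw [sub_mul, mul_sub, Algebra.commutes]
    congr 1
    exact Subtype.ext (euler_commute_zero d b.2)
  rw [smul_eq_mul, smul_eq_mul, mul_assoc, ← h, mul_assoc]

/-- The algebra `𝔻₀ / 𝔻₀ (E - λ)`, the degree zero part of `𝔻 / 𝔻 (E - λ)`. -/
abbrev TwistedOps (lam : K) : Type u := weylZero K d ⧸ eulerIdeal d lam

/-! ### Weight spaces, Euler modules and torsion modules -/

section Modules

variable {M : Type*} [AddCommGroup M] [Module (Weyl K n) M]

variable (M) in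
/-- The `μ`-eigenspace `M^μ` of the Euler field on a `𝔻`-module `M`, as a `𝔻₀`-module. -/
def weightSpace (μ : K) : Submodule (weylZero K d) M where
  carrier := {m | euler K d • m = algebraMap K (Weyl K n) μ • m}
  zero_mem' := by simp
  add_mem' {a b} ha hb := by
    simp only [Set.mem_ofPred_eq] at *
    rw [smul_add, smul_add, ha, hb]
  smul_mem' w m hm := by
    simp only [Set.mem_ofPred_eq] at *
    rw [Subalgebra.smul_def, ← mul_smul, euler_commute_zero d w.2, mul_smul, hm, ← mul_smul,
      ← mul_smul, Algebra.commutes]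

variable {d} in
lemma mem_weightSpace {μ : K} {m : M} :
    m ∈ weightSpace d M μ ↔ euler K d • m = algebraMap K (Weyl K n) μ • m := Iff.rfl

variable (M) in
/-- A `𝔻`-module is `λ`-Euler if it is the sum of the eigenspaces `M^(λ + k)`, `k ∈ ℤ`, of the
Euler field. It is then graded by `M_k = M^(λ + k)`. -/
def IsEulerModule (lam : K) : Prop := ⨆ k : ℤ, weightSpace d M (lam + k) = ⊤

variable (K) in
/-- An element `m` of a `𝔻`-module is torsion if `𝔸ₖ m = 0` for all large `k`. -/
def IsTorsionElt (m : M) : Prop :=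
  ∃ N : ℤ, ∀ k > N, ∀ a ∈ polyDegree K d k, (polyToWeyl a : Weyl K n) • m = 0


lemma x_pow_eq (i : Fin (n + 1)) (k : ℕ) :
    (Weyl.x i : Weyl K n) ^ k = polyToWeyl (MvPolynomial.X i ^ k) := by
  rw [map_pow]; rfl

lemma isTorsionElt_iff (m : M) :
    IsTorsionElt K d m ↔ ∀ i, ∃ k : ℕ, (Weyl.x i : Weyl K n) ^ k • m = 0 := by
  constructor
  · rintro ⟨N, hN⟩ i
    refine ⟨N.toNat + 1, ?_⟩
    rw [x_pow_eq]
    refine hN ((N.toNat + 1) • ((d i : ℕ) : ℤ)) ?_ _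
      ((MvPolynomial.isWeightedHomogeneous_X K (fun i => ((d i : ℕ) : ℤ)) i).pow _)
    have h1 : (1 : ℤ) ≤ ((d i : ℕ) : ℤ) := by exact_mod_cast (d i).pos
    have h2 := Int.self_le_toNat N
    rw [nsmul_eq_mul]
    push_cast
    nlinarith
  · intro h
    choose k hk using h
    refine ⟨∑ i, (k i : ℤ) * ((d i : ℕ) : ℤ), fun l hl a ha => ?_⟩
    have ha' : MvPolynomial.IsWeightedHomogeneous (fun i => ((d i : ℕ) : ℤ)) a l := ha
    rw [a.as_sum, map_sum, Finset.sum_smul]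
    refine Finset.sum_eq_zero fun α hα => ?_
    have hw := ha' (MvPolynomial.mem_support_iff.1 hα)
    rw [Finsupp.weight_apply, Finsupp.sum_fintype _ _ (by simp)] at hw
    obtain ⟨i, hi⟩ : ∃ i, k i ≤ α i := by
      by_contra hcon
      push Not at hcon
      have : ∑ i, (α i : ℕ) • ((d i : ℕ) : ℤ) ≤ ∑ i, (k i : ℤ) * ((d i : ℕ) : ℤ) := by
        refine Finset.sum_le_sum fun i _ => ?_
        rw [nsmul_eq_mul]
        have := hcon i
        gcongr
      omega
    have hsplit : MvPolynomial.monomial α (MvPolynomial.coeff α a) =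
        MvPolynomial.monomial (α - Finsupp.single i (k i)) (MvPolynomial.coeff α a) *
          MvPolynomial.X i ^ k i := by
      rw [MvPolynomial.X_pow_eq_monomial, MvPolynomial.monomial_mul, mul_one,
        tsub_add_cancel_of_le (Finsupp.single_le_iff.2 hi)]
    rw [hsplit, map_mul, mul_smul, ← x_pow_eq, hk, smul_zero]

lemma x_pow_smul_eq_zero_of_le {m : M} {i : Fin (n + 1)} {k l : ℕ} (hkl : k ≤ l)
    (h : (Weyl.x i : Weyl K n) ^ k • m = 0) : (Weyl.x i : Weyl K n) ^ l • m = 0 := by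
  obtain ⟨c, rfl⟩ := Nat.exists_eq_add_of_le' hkl
  rw [pow_add, mul_smul, h, smul_zero]

lemma IsTorsionElt.smul {m : M} (h : IsTorsionElt K d m) (w : Weyl K n) :
    IsTorsionElt K d (w • m) := by
  induction w using Weyl.induction generalizing m with
  | hx j =>
    rw [isTorsionElt_iff] at h ⊢
    intro i
    obtain ⟨k, hk⟩ := h i
    refine ⟨k, ?_⟩
    have : (Weyl.x i : Weyl K n) ^ k * Weyl.x j = Weyl.x j * Weyl.x i ^ k := by
      rw [x_pow_eq, Weyl.x, ← map_mul, ← map_mul, mul_comm]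
    rw [← mul_smul, this, mul_smul, hk, smul_zero]
  | hd j =>
    rw [isTorsionElt_iff] at h ⊢
    intro i
    obtain ⟨k, hk⟩ := h i
    refine ⟨k + 1, ?_⟩
    have h1 := del_mul_poly (K := K) j (MvPolynomial.X i ^ (k + 1))
    rw [← x_pow_eq, Derivation.leibniz_pow, Nat.add_sub_cancel, smul_eq_mul, mul_comm (_ ^ k),
      ← smul_mul_assoc, map_mul, ← x_pow_eq] at h1
    rw [← mul_smul, eq_sub_iff_add_eq.2 h1.symm, sub_smul, mul_smul, mul_smul,
      x_pow_smul_eq_zero_of_le k.le_succ hk, hk, smul_zero, smul_zero, sub_zero]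
  | hc c =>
    rw [isTorsionElt_iff] at h ⊢
    intro i
    obtain ⟨k, hk⟩ := h i
    refine ⟨k, ?_⟩
    rw [← mul_smul, ← Algebra.commutes, mul_smul, hk, smul_zero]
  | hadd v w hv hw =>
    have h1 := hv h
    have h2 := hw h
    rw [isTorsionElt_iff] at h1 h2 ⊢
    intro i
    obtain ⟨k, hk⟩ := h1 i
    obtain ⟨l, hl⟩ := h2 i
    refine ⟨max k l, ?_⟩
    rw [add_smul, smul_add, x_pow_smul_eq_zero_of_le (le_max_left _ _) hk,
      x_pow_smul_eq_zero_of_le (le_max_right _ _) hl, add_zero]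
  | hmul v w hv hw =>
    rw [mul_smul]
    exact hv (hw h)

lemma IsTorsionElt.add {a b : M} (ha : IsTorsionElt K d a) (hb : IsTorsionElt K d b) :
    IsTorsionElt K d (a + b) := by
  rw [isTorsionElt_iff] at *
  intro i
  obtain ⟨k, hk⟩ := ha i
  obtain ⟨l, hl⟩ := hb i
  refine ⟨max k l, ?_⟩
  rw [smul_add, x_pow_smul_eq_zero_of_le (le_max_left _ _) hk,
    x_pow_smul_eq_zero_of_le (le_max_right _ _) hl, add_zero]

variable (K M) in
/-- The torsion submodule `τ(M)` of a `𝔻`-module. -/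
def torsionSubmodule : Submodule (Weyl K n) M where
  carrier := {m | IsTorsionElt K d m}
  zero_mem' := ⟨0, fun _ _ _ _ => smul_zero _⟩
  add_mem' := IsTorsionElt.add d
  smul_mem' w _ h := IsTorsionElt.smul d h w

variable {d} in
lemma mem_torsionSubmodule {m : M} : m ∈ torsionSubmodule K d M ↔ IsTorsionElt K d m := Iff.rfl

section Maps

variable {N : Type*} [AddCommGroup N] [Module (Weyl K n) N]

variable {d} in
lemma IsTorsionElt.map {m : M} (h : IsTorsionElt K d m) (f : M →ₗ[Weyl K n] N) :
    IsTorsionElt K d (f m) := by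
  obtain ⟨N, hN⟩ := h
  exact ⟨N, fun k hk a ha => by rw [← map_smul, hN k hk a ha, map_zero]⟩

variable {d} in
lemma IsTorsionElt.of_map {m : M} {f : M →ₗ[Weyl K n] N} (h : IsTorsionElt K d (f m))
    (hf : ∀ x, f x = 0 → IsTorsionElt K d x) : IsTorsionElt K d m := by
  rw [isTorsionElt_iff] at h ⊢
  intro i
  obtain ⟨k, hk⟩ := h i
  rw [← map_smul] at hk
  obtain ⟨l, hl⟩ := (isTorsionElt_iff d _).1 (hf _ hk) i
  exact ⟨l + k, by rw [pow_add, mul_smul, hl]⟩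

end Maps

/-! #### Sums of eigenvectors -/

/-- The element `∏_{k ∈ S} (E - λ - k)` of the Weyl algebra. -/
def eulerPoly (lam : K) (S : Finset ℤ) : Weyl K n :=
  Polynomial.aeval (euler K d) (∏ k ∈ S, (Polynomial.X - Polynomial.C (lam + k)))

lemma eulerPoly_smul_eq_zero_of_subset {lam : K} {S T : Finset ℤ} (h : S ⊆ T) {m : M}
    (hm : eulerPoly d lam S • m = 0) : eulerPoly d lam T • m = 0 := by
  obtain ⟨q, hq⟩ := Finset.prod_dvd_prod_of_subset S T
    (fun k : ℤ => (Polynomial.X - Polynomial.C (lam + k) : Polynomial K)) h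
  rw [eulerPoly, hq, mul_comm, map_mul, mul_smul]
  exact (congrArg _ hm).trans (smul_zero _)

lemma aeval_euler_smul (p : Polynomial K) {μ : K} {m : M} (hm : m ∈ weightSpace d M μ) :
    Polynomial.aeval (euler K d) p • m = algebraMap K (Weyl K n) (p.eval μ) • m := by
  induction p using Polynomial.induction_on' with
  | add p q hp hq => rw [map_add, add_smul, hp, hq, Polynomial.eval_add, map_add, add_smul]
  | monomial k c =>
    rw [Polynomial.aeval_monomial, Polynomial.eval_monomial, map_mul, mul_smul, mul_smul]
    congr 1
    induction k with
    | zero => simp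
    | succ k ih =>
      rw [pow_succ, mul_smul, mem_weightSpace.1 hm, ← mul_smul, ← Algebra.commutes, mul_smul, ih,
        ← mul_smul, ← map_mul, pow_succ, mul_comm]

lemma exists_eulerPoly_of_mem_iSup {lam : K} {m : M}
    (hm : m ∈ ⨆ k : ℤ, weightSpace d M (lam + k)) : ∃ S, eulerPoly d lam S • m = 0 := by
  induction hm using Submodule.iSup_induction' with
  | mem k m hm =>
    refine ⟨{k}, ?_⟩
    rw [eulerPoly, aeval_euler_smul d _ hm]
    simp
  | zero => exact ⟨∅, smul_zero _⟩
  | add a b _ _ ha hb =>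
    obtain ⟨S, hS⟩ := ha
    obtain ⟨T, hT⟩ := hb
    refine ⟨S ∪ T, ?_⟩
    rw [smul_add, eulerPoly_smul_eq_zero_of_subset d Finset.subset_union_left hS,
      eulerPoly_smul_eq_zero_of_subset d Finset.subset_union_right hT, add_zero]

lemma algebraMap_smul_mem {lam : K} {m : M} (c : K)
    (hm : m ∈ ⨆ k : ℤ, weightSpace d M (lam + k)) :
    algebraMap K (Weyl K n) c • m ∈ ⨆ k : ℤ, weightSpace d M (lam + k) :=
  Submodule.smul_mem _ (algebraMap K (weylZero K d) c) hm

lemma mem_iSup_of_eulerPoly [CharZero K] {lam : K} (S : Finset ℤ) {m : M}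
    (hm : eulerPoly d lam S • m = 0) : m ∈ ⨆ k : ℤ, weightSpace d M (lam + k) := by
  induction S using Finset.induction_on generalizing m with
  | empty =>
    have : m = 0 := by simpa [eulerPoly] using hm
    rw [this]; exact zero_mem _
  | insert k S hk ih =>
    set c : K := (∏ j ∈ S, (Polynomial.X - Polynomial.C (lam + j))).eval (lam + k) with hc
    have hc0 : c ≠ 0 := by
      rw [hc, Polynomial.eval_prod, Finset.prod_ne_zero_iff]
      intro j hj
      rw [Polynomial.eval_sub, Polynomial.eval_X, Polynomial.eval_C, add_sub_add_left_eq_sub,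
        sub_ne_zero]
      intro h
      rw [Int.cast_inj] at h
      exact hk (h ▸ hj)
    have hu : eulerPoly d lam S • m ∈ weightSpace d M (lam + k) := by
      rw [eulerPoly, Finset.prod_insert hk, map_mul, mul_smul] at hm
      rw [mem_weightSpace, ← sub_eq_zero, ← sub_smul]
      simpa [eulerPoly] using hm
    have hv : algebraMap K (Weyl K n) c⁻¹ • (eulerPoly d lam S • m) ∈
        weightSpace d M (lam + k) :=
      Submodule.smul_mem _ (algebraMap K (weylZero K d) c⁻¹) hu
    have h1 : m - algebraMap K (Weyl K n) c⁻¹ • (eulerPoly d lam S • m) ∈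
        ⨆ k : ℤ, weightSpace d M (lam + k) := by
      apply ih
      have hE : eulerPoly d lam S • (algebraMap K (Weyl K n) c⁻¹ • (eulerPoly d lam S • m)) = _ :=
        aeval_euler_smul d _ hv
      rw [smul_sub, hE, ← mul_smul, ← map_mul]
      rw [← hc, mul_inv_cancel₀ hc0, map_one, one_smul, sub_self]
    have h2 := Submodule.mem_iSup_of_mem (p := fun k : ℤ => weightSpace d M (lam + k)) k hv
    simpa using add_mem h1 h2

lemma isEulerModule_iff [CharZero K] {lam : K} :
    IsEulerModule d M lam ↔ ∀ m : M, ∃ S, eulerPoly d lam S • m = 0 := by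
  refine ⟨fun h m => exists_eulerPoly_of_mem_iSup d (h ▸ Submodule.mem_top), fun h => ?_⟩
  refine Submodule.eq_top_iff'.2 fun m => ?_
  obtain ⟨S, hS⟩ := h m
  exact mem_iSup_of_eulerPoly d S hS

lemma weylDegree_smul_mem {w : Weyl K n} {k : ℤ} (hw : w ∈ weylDegree K d k) {lam : K} {m : M}
    (hm : m ∈ ⨆ k : ℤ, weightSpace d M (lam + k)) : w • m ∈ ⨆ k : ℤ, weightSpace d M (lam + k) := by
  induction hm using Submodule.iSup_induction' with
  | mem j m hm =>
    refine Submodule.mem_iSup_of_mem (p := fun k : ℤ => weightSpace d M (lam + k)) (j + k) ?_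
    rw [mem_weightSpace] at hm ⊢
    rw [← mul_smul, euler_commute d hw, add_smul, mul_smul, hm, ← mul_smul, ← Algebra.commutes,
      ← add_smul, Int.cast_add, Algebra.smul_def, ← mul_smul]
    simp only [map_add, add_mul, add_assoc]
  | zero => rw [smul_zero]; exact zero_mem _
  | add a b _ _ ha hb => rw [smul_add]; exact add_mem ha hb

variable (M) in
/-- The largest `λ`-Euler submodule of a `𝔻`-module. -/
def eulerPart (lam : K) : Submodule (Weyl K n) M where
  carrier := (⨆ k : ℤ, weightSpace d M (lam + k) : Submodule (weylZero K d) M)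
  zero_mem' := Submodule.zero_mem _
  add_mem' := Submodule.add_mem _
  smul_mem' w m hm := by
    change w • m ∈ ⨆ k : ℤ, weightSpace d M (lam + k)
    induction w using Weyl.induction generalizing m with
    | hx i => exact weylDegree_smul_mem d (x_mem_weylDegree d i) hm
    | hd i => exact weylDegree_smul_mem d (del_mem_weylDegree d i) hm
    | hc c => exact algebraMap_smul_mem d c hm
    | hadd v w hv hw => rw [add_smul]; exact add_mem (hv m hm) (hw m hm)
    | hmul v w hv hw => rw [mul_smul]; exact hv _ (hw m hm)

lemma mem_eulerPart_iff [CharZero K] {lam : K} {m : M} :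
    m ∈ eulerPart d M lam ↔ ∃ S, eulerPoly d lam S • m = 0 :=
  ⟨exists_eulerPoly_of_mem_iSup d, fun ⟨S, hS⟩ => mem_iSup_of_eulerPoly d S hS⟩

/-! #### Closed modules -/

variable (K) in
/-- An element of a module is torsion modulo a submodule. -/
def TorsionMod (P : Submodule (Weyl K n) M) (m : M) : Prop :=
  ∀ i, ∃ k : ℕ, (Weyl.x i : Weyl K n) ^ k • m ∈ P

lemma torsionMod_iff (P : Submodule (Weyl K n) M) (m : M) :
    TorsionMod K P m ↔ IsTorsionElt K d (P.mkQ m) := by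
  rw [isTorsionElt_iff]
  refine forall_congr' fun i => exists_congr fun k => ?_
  rw [← map_smul, Submodule.mkQ_apply, Submodule.Quotient.mk_eq_zero]

lemma TorsionMod.trans {P P' : Submodule (Weyl K n) M} {m : M} (h : TorsionMod K P m)
    (h' : ∀ p ∈ P, TorsionMod K P' p) : TorsionMod K P' m := by
  intro i
  obtain ⟨k, hk⟩ := h i
  obtain ⟨l, hl⟩ := h' _ hk i
  exact ⟨l + k, by rwa [pow_add, mul_smul]⟩

lemma isTorsionElt_iff_bot (m : M) :
    IsTorsionElt K d m ↔ TorsionMod K (⊥ : Submodule (Weyl K n) M) m := by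
  simp [isTorsionElt_iff, TorsionMod]

/-- The submodule of elements that are torsion modulo a submodule. -/
def torsionClosure (P : Submodule (Weyl K n) M) : Submodule (Weyl K n) M :=
  (torsionSubmodule K d (M ⧸ P)).comap P.mkQ

lemma mem_torsionClosure {P : Submodule (Weyl K n) M} {m : M} :
    m ∈ torsionClosure d P ↔ TorsionMod K P m := (torsionMod_iff d P m).symm

lemma eq_of_torsionMod {N : Type*} [AddCommGroup N] [Module (Weyl K n) N]
    (hN : ∀ x : N, IsTorsionElt K d x → x = 0) {P : Submodule (Weyl K n) M}
    (hP : ∀ m, TorsionMod K P m) {f g : M →ₗ[Weyl K n] N} (hfg : ∀ p ∈ P, f p = g p) : f = g := by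
  ext m
  rw [← sub_eq_zero]
  refine hN _ ((isTorsionElt_iff d _).2 fun i => ?_)
  obtain ⟨k, hk⟩ := hP m i
  exact ⟨k, by rw [smul_sub, ← map_smul, ← map_smul, hfg _ hk, sub_self]⟩

end Modules

/-- Every `𝔻`-module maps, with torsion kernel and cokernel, to a torsion-free module that is
closed with respect to such maps. -/
lemma exists_closed (M : Type u) [AddCommGroup M] [Module (Weyl K n) M] :
    ∃ (N : Type u) (_ : AddCommGroup N) (_ : Module (Weyl K n) N) (u : M →ₗ[Weyl K n] N),
      (∀ m, u m = 0 → IsTorsionElt K d m) ∧ (∀ y, TorsionMod K (LinearMap.range u) y) ∧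
      ∀ (X Y : Type u) [AddCommGroup X] [AddCommGroup Y] [Module (Weyl K n) X]
        [Module (Weyl K n) Y] (g : X →ₗ[Weyl K n] Y), (∀ x, g x = 0 → IsTorsionElt K d x) →
        (∀ y, TorsionMod K (LinearMap.range g) y) →
        ∀ h : X →ₗ[Weyl K n] N, ∃! h' : Y →ₗ[Weyl K n] N, h' ∘ₗ g = h := by
  let E : ModuleCat.{u} (Weyl K n) :=
    Injective.under (ModuleCat.of _ (M ⧸ torsionSubmodule K d M))
  let j : (M ⧸ torsionSubmodule K d M) →ₗ[Weyl K n] E :=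
    (Injective.ι (ModuleCat.of _ (M ⧸ torsionSubmodule K d M))).hom
  have hj : Function.Injective j := (ModuleCat.mono_iff_injective _).1
    (inferInstanceAs (Mono (Injective.ι (ModuleCat.of _ (M ⧸ torsionSubmodule K d M)))))
  have : Injective (ModuleCat.of (Weyl K n) E) :=
    inferInstanceAs (Injective (Injective.under (ModuleCat.of (Weyl K n) _)))
  have hE : Module.Injective (Weyl K n) E :=
    Module.injective_module_of_injective_object (Weyl K n) E
  let q : E →ₗ[Weyl K n] E ⧸ torsionSubmodule K d E := (torsionSubmodule K d E).mkQ
  let v : M →ₗ[Weyl K n] E ⧸ torsionSubmodule K d E :=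
    q ∘ₗ j ∘ₗ (torsionSubmodule K d M).mkQ
  have hF : ∀ x : E ⧸ torsionSubmodule K d E, IsTorsionElt K d x → x = 0 := by
    intro x hx
    obtain ⟨e, rfl⟩ := (torsionSubmodule K d E).mkQ_surjective x
    have h : IsTorsionElt K d e := IsTorsionElt.of_map hx fun y hy => by
      rwa [Submodule.mkQ_apply, Submodule.Quotient.mk_eq_zero] at hy
    rw [Submodule.mkQ_apply, Submodule.Quotient.mk_eq_zero]
    exact h
  have hv : ∀ m, v m = 0 → IsTorsionElt K d m := by
    intro m hm
    have h1 : IsTorsionElt K d (j ((torsionSubmodule K d M).mkQ m)) := by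
      change q (j _) = 0 at hm
      rwa [Submodule.mkQ_apply, Submodule.Quotient.mk_eq_zero] at hm
    refine IsTorsionElt.of_map (f := (torsionSubmodule K d M).mkQ)
      (IsTorsionElt.of_map h1 fun x hx => ?_) fun x hx => ?_
    · rw [hj (hx.trans (map_zero j).symm)]
      exact ⟨0, fun _ _ _ _ => smul_zero _⟩
    · rwa [Submodule.mkQ_apply, Submodule.Quotient.mk_eq_zero] at hx
  let P := torsionClosure d (LinearMap.range v)
  have hvP : ∀ m, v m ∈ P := fun m => (mem_torsionClosure d).2 fun i =>
    ⟨0, by rw [pow_zero, one_smul]; exact ⟨m, rfl⟩⟩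
  have hPF : ∀ x : P, IsTorsionElt K d x → x = 0 := fun x hx =>
    Subtype.ext (hF _ (hx.map P.subtype))
  refine ⟨P, inferInstance, inferInstance, v.codRestrict P hvP,
    fun m hm => hv m (congrArg Subtype.val hm), ?_, ?_⟩
  · intro y i
    obtain ⟨k, m, hm⟩ := (mem_torsionClosure d).1 y.2 i
    exact ⟨k, m, Subtype.ext hm⟩
  · intro X Y _ _ _ _ g hg1 hg2 h
    have huniq : ∀ h₁ h₂ : Y →ₗ[Weyl K n] P, h₁ ∘ₗ g = h → h₂ ∘ₗ g = h → h₁ = h₂ := by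
      intro h₁ h₂ e₁ e₂
      refine eq_of_torsionMod d hPF hg2 ?_
      rintro _ ⟨x, rfl⟩
      exact LinearMap.congr_fun (e₁.trans e₂.symm) x
    suffices hex : ∃ h' : Y →ₗ[Weyl K n] P, h' ∘ₗ g = h by
      obtain ⟨h', hh'⟩ := hex
      exact ⟨h', hh', fun h₂ e₂ => huniq _ _ e₂ hh'⟩
    have hker : ∀ x, g x = 0 → h x = 0 := fun x hx => hPF _ ((hg1 x hx).map h)
    -- the submodule of `X` of elements that `h` maps to the image of `M`
    let X₁ : Submodule (Weyl K n) X := (LinearMap.range v).comap (P.subtype ∘ₗ h)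
    have hX₁ : ∀ x, TorsionMod K X₁ x := by
      intro x i
      obtain ⟨k, hk⟩ := (mem_torsionClosure d).1 (h x).2 i
      exact ⟨k, by simpa [X₁] using hk⟩
    -- the image of `M` in `E / τ(E)` lifts to `E`
    let R : Submodule (Weyl K n) E := LinearMap.range j
    have hqR : Function.Injective (q ∘ₗ R.subtype) := by
      rw [← LinearMap.ker_eq_bot, LinearMap.ker_eq_bot']
      rintro ⟨_, y, rfl⟩ hy
      obtain ⟨m, rfl⟩ := (torsionSubmodule K d M).mkQ_surjective y
      have hm : IsTorsionElt K d m := hv m hy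
      have : (torsionSubmodule K d M).mkQ m = 0 := by
        rw [Submodule.mkQ_apply, Submodule.Quotient.mk_eq_zero]; exact hm
      exact Subtype.ext ((congrArg j this).trans (map_zero j))
    let e := LinearEquiv.ofInjective (q ∘ₗ R.subtype) hqR
    have hXR : ∀ x : X₁, (h x : E ⧸ torsionSubmodule K d E) ∈ LinearMap.range (q ∘ₗ R.subtype) := by
      rintro ⟨x, m, hm⟩
      exact ⟨⟨j ((torsionSubmodule K d M).mkQ m), _, rfl⟩, hm⟩
    let l : X₁ →ₗ[Weyl K n] E := R.subtype ∘ₗ e.symm.toLinearMap ∘ₗ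
      (P.subtype ∘ₗ h ∘ₗ X₁.subtype).codRestrict _ hXR
    have hl : ∀ x, q (l x) = h x := by
      intro x
      exact congrArg Subtype.val (e.apply_symm_apply ⟨_, hXR x⟩)
    -- descend `l` to the image of `X₁` in `Y` and extend
    let g₁ : X₁ →ₗ[Weyl K n] Y := g ∘ₗ X₁.subtype
    have hl0 : LinearMap.ker g₁ ≤ LinearMap.ker l := by
      intro x hx
      have h0 : h x = 0 := hker _ hx
      have : (P.subtype ∘ₗ h ∘ₗ X₁.subtype).codRestrict _ hXR x = 0 :=
        Subtype.ext (congrArg (fun p : P => (p : E ⧸ torsionSubmodule K d E)) h0)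
      rw [LinearMap.mem_ker]
      simp only [l, LinearMap.comp_apply, this, map_zero]
    obtain ⟨H, hH⟩ := hE.out ((LinearMap.ker g₁).liftQ g₁ le_rfl)
      (LinearMap.ker_eq_bot.1 (Submodule.ker_liftQ_eq_bot _ _ _ le_rfl))
      ((LinearMap.ker g₁).liftQ l hl0)
    have hHl : ∀ x : X₁, H (g x) = l x := fun x => hH (Submodule.Quotient.mk x)
    have hHP : ∀ y, (q ∘ₗ H) y ∈ P := by
      intro y
      rw [mem_torsionClosure]
      refine TorsionMod.trans (P := P) (fun i => ?_) fun p hp => (mem_torsionClosure d).1 hp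
      obtain ⟨k, x, hx⟩ := hg2 y i
      obtain ⟨k', hk'⟩ := hX₁ x i
      refine ⟨k' + k, ?_⟩
      have h3 := hHl ⟨_, hk'⟩
      rw [← map_smul, pow_add, mul_smul, ← hx, ← map_smul, LinearMap.comp_apply, h3, hl]
      exact Subtype.prop _
    refine ⟨(q ∘ₗ H).codRestrict P hHP, ?_⟩
    refine eq_of_torsionMod d hPF hX₁ fun x hx => Subtype.ext ?_
    exact (congrArg q (hHl ⟨x, hx⟩)).trans (hl ⟨x, hx⟩)

end Weyl

/-! ### The category of twisted D-modules -/

section Cat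

variable {K : Type u} [Field K] {n : ℕ} (d : Fin (n + 1) → ℕ+) (lam : K)

/-- The property of a `𝔻`-module of being `λ`-Euler. -/
def isEuler : ObjectProperty (ModuleCat.{u} (Weyl K n)) := fun M => IsEulerModule d M lam

/-- The category of `λ`-Euler `𝔻`-modules. As `𝔻`-linear maps commute with the Euler field, they
automatically preserve the canonical gradings. -/
abbrev EulerMod := (isEuler d lam).FullSubcategory

variable (K) in
/-- The property of a `𝔻`-module of being torsion as an `𝔸`-module. -/
def isTorsion : ObjectProperty (ModuleCat.{u} (Weyl K n)) := fun M => ∀ m : M, IsTorsionElt K d m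

instance : (isTorsion K d).IsSerreClass where
  exists_zero := ⟨ModuleCat.of _ PUnit, ModuleCat.isZero_of_subsingleton _,
    fun _ => ⟨0, fun _ _ _ _ => rfl⟩⟩
  prop_of_mono {M N} f hf hN m := by
    rw [ModuleCat.mono_iff_injective] at hf
    refine IsTorsionElt.of_map (f := f.hom) (hN _) fun x hx => ?_
    rw [hf (hx.trans (map_zero f.hom).symm)]
    exact ⟨0, fun _ _ _ _ => smul_zero _⟩
  prop_of_epi {M N} f hf hM m := by
    rw [ModuleCat.epi_iff_surjective] at hf
    obtain ⟨x, rfl⟩ := hf m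
    exact (hM x).map f.hom
  prop_X₂_of_shortExact {S} hS h₁ h₃ m := by
    refine IsTorsionElt.of_map (f := S.g.hom) (h₃ _) fun x hx => ?_
    obtain ⟨y, rfl⟩ := (ShortComplex.moduleCat_exact_iff S).1 hS.exact x hx
    exact (h₁ y).map S.f.hom

variable [CharZero K]

instance : (isEuler d lam).ContainsZero where
  exists_zero := ⟨ModuleCat.of _ PUnit, ModuleCat.isZero_of_subsingleton _,
    (isEulerModule_iff d).2 fun _ => ⟨∅, rfl⟩⟩

instance : (isEuler d lam).IsClosedUnderSubobjects where
  prop_of_mono {M N} f hf hN := by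
    rw [ModuleCat.mono_iff_injective] at hf
    refine (isEulerModule_iff d).2 fun m => ?_
    obtain ⟨S, hS⟩ := (isEulerModule_iff d).1 hN (f.hom m)
    exact ⟨S, hf (by simpa using hS)⟩

instance : (isEuler d lam).IsClosedUnderQuotients where
  prop_of_epi {M N} f hf hM := by
    rw [ModuleCat.epi_iff_surjective] at hf
    refine (isEulerModule_iff d).2 fun m => ?_
    obtain ⟨x, rfl⟩ := hf m
    obtain ⟨S, hS⟩ := (isEulerModule_iff d).1 hM x
    exact ⟨S, by
      have := congrArg f.hom hS
      simpa using this⟩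

instance : (isEuler d lam).IsClosedUnderFiniteProducts where
  isClosedUnderLimitsOfShape J _ := ⟨by
    rintro X ⟨p⟩
    have := Fintype.ofFinite J
    refine (isEulerModule_iff d).2 fun m => ?_
    have h := fun j : J => (isEulerModule_iff d).1 (p.prop_diag_obj ⟨j⟩) ((p.π.app ⟨j⟩).hom m)
    choose S hS using h
    classical
    refine ⟨Finset.univ.biUnion S, ?_⟩
    refine Concrete.isLimit_ext p.diag p.isLimit _ _ ?_
    rintro ⟨j⟩
    have h1 := eulerPoly_smul_eq_zero_of_subset d
      (Finset.subset_biUnion_of_mem S (Finset.mem_univ j)) (hS j)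
    rw [← map_smul] at h1
    exact h1.trans (map_zero (p.π.app ⟨j⟩).hom).symm⟩

instance : PreservesFiniteLimits (isEuler d lam).ι := by
  rw [((Functor.preservesFiniteLimits_tfae (isEuler d lam).ι).out 3 2 :)]
  intro _ _ f
  exact (isEuler d lam).preservesKernels_ι f

instance : PreservesFiniteColimits (isEuler d lam).ι := by
  rw [((Functor.preservesFiniteColimits_tfae (isEuler d lam).ι).out 3 2 :)]
  intro _ _ f
  exact (isEuler d lam).preservesCokernels_ι f

/-- The property of a `λ`-Euler `𝔻`-module of being torsion. -/
abbrev isTorsionEuler : ObjectProperty (EulerMod d lam) :=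
  (isTorsion K d).inverseImage (isEuler d lam).ι

/-- The category of `λ`-twisted D-modules on `[ℙ(V)]`: the quotient of the category of `λ`-Euler
`𝔻`-modules by the Serre subcategory of torsion modules. -/
abbrev QCoh := (isTorsionEuler d lam).isoModSerre.Localization

/-- The quotient functor `π` from `λ`-Euler `𝔻`-modules to `λ`-twisted D-modules. -/
abbrev quot : EulerMod d lam ⥤ QCoh d lam := (isTorsionEuler d lam).isoModSerre.Q

instance : Abelian (QCoh d lam) :=
  ObjectProperty.SerreClassLocalization.abelian (quot d lam) (isTorsionEuler d lam)

end Cat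

/-! ### The section functor -/

section SectionFunctor

variable {K : Type u} [Field K] [CharZero K] {n : ℕ} (d : Fin (n + 1) → ℕ+) (lam : K)

lemma isoModSerre_iff {X Y : EulerMod d lam} (f : X ⟶ Y) :
    (isTorsionEuler d lam).isoModSerre f ↔
      (∀ x, f.hom.hom x = 0 → IsTorsionElt K d x) ∧
        ∀ y, TorsionMod K (LinearMap.range f.hom.hom) y := by
  have h1 : isTorsion K d ((isEuler d lam).ι.obj (kernel f)) ↔
      ∀ x, f.hom.hom x = 0 → IsTorsionElt K d x := by
    rw [(isTorsion K d).prop_iff_of_iso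
      (PreservesKernel.iso (isEuler d lam).ι f ≪≫ ModuleCat.kernelIsoKer _)]
    constructor
    · intro h x hx
      exact (h ⟨x, hx⟩).map (LinearMap.ker f.hom.hom).subtype
    · rintro h ⟨x, hx⟩
      exact IsTorsionElt.of_map (f := (LinearMap.ker f.hom.hom).subtype) (h x hx) fun y hy => by
        rw [Subtype.ext (a1 := y) (a2 := 0) hy]
        exact ⟨0, fun _ _ _ _ => smul_zero _⟩
  have h2 : isTorsion K d ((isEuler d lam).ι.obj (cokernel f)) ↔
      ∀ y, TorsionMod K (LinearMap.range f.hom.hom) y := by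
    rw [(isTorsion K d).prop_iff_of_iso
      (PreservesCokernel.iso (isEuler d lam).ι f ≪≫ ModuleCat.cokernelIsoRangeQuotient _)]
    constructor
    · intro h y
      exact (torsionMod_iff d _ _).2 (h _)
    · intro h z
      obtain ⟨y, rfl⟩ := (LinearMap.range f.hom.hom).mkQ_surjective z
      exact (torsionMod_iff d _ _).1 (h y)
  exact and_congr h1 h2

/-- Every `λ`-Euler module has a reflection in the category of modules that are local for the
maps with torsion kernel and cokernel. -/
lemma exists_local (M : EulerMod d lam) :
    ∃ (N : EulerMod d lam) (u : M ⟶ N), (isTorsionEuler d lam).isoModSerre u ∧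
      (isTorsionEuler d lam).isoModSerre.isLocal N := by
  obtain ⟨N, _, _, u, hu1, hu2, hN⟩ := exists_closed (K := K) (n := n) d M.obj
  let N' : EulerMod d lam := ⟨ModuleCat.of (Weyl K n) (eulerPart d N lam), by
    refine (isEulerModule_iff d).2 fun m => ?_
    obtain ⟨S, hS⟩ := (mem_eulerPart_iff d).1 m.2
    exact ⟨S, Subtype.ext hS⟩⟩
  have key : ∀ (X : EulerMod d lam) (f : X.obj →ₗ[Weyl K n] N) (x : X.obj),
      f x ∈ eulerPart d N lam := by
    intro X f x
    obtain ⟨S, hS⟩ := (isEulerModule_iff d).1 X.property x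
    exact (mem_eulerPart_iff d).2 ⟨S, by rw [← map_smul, hS, map_zero]⟩
  let u' : M ⟶ N' := ObjectProperty.homMk (ModuleCat.ofHom (u.codRestrict _ (key M u)))
  refine ⟨N', u', (isoModSerre_iff d lam u').2 ⟨?_, ?_⟩, ?_⟩
  · intro x hx
    exact hu1 x (congrArg Subtype.val hx)
  · intro y i
    obtain ⟨k, m, hm⟩ := hu2 y.1 i
    exact ⟨k, m, Subtype.ext hm⟩
  · intro X Y g hg
    rw [isoModSerre_iff] at hg
    have hg' := hN X.obj Y.obj g.hom.hom hg.1 hg.2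
    constructor
    · intro a b hab
      obtain ⟨_, _, h⟩ := hg' ((eulerPart d N lam).subtype ∘ₗ (g ≫ a).hom.hom)
      have ha := h ((eulerPart d N lam).subtype ∘ₗ a.hom.hom) rfl
      have hb := h ((eulerPart d N lam).subtype ∘ₗ b.hom.hom) (by
        have hab' : g ≫ a = g ≫ b := hab
        rw [hab']; rfl)
      ext y
      exact LinearMap.congr_fun (ha.trans hb.symm) y
    · intro a
      obtain ⟨h', hh', -⟩ := hg' ((eulerPart d N lam).subtype ∘ₗ a.hom.hom)
      refine ⟨ObjectProperty.homMk (ModuleCat.ofHom (h'.codRestrict _ (key Y h'))), ?_⟩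
      ext x
      exact LinearMap.congr_fun hh' x

/-- The quotient functor has a right adjoint. -/
instance : (quot d lam).IsLeftAdjoint := by
  have : ∀ A, HasTerminal (CostructuredArrow (quot d lam) A) := by
    intro A
    let W := (isTorsionEuler d lam).isoModSerre
    have := Localization.essSurj (quot d lam) W
    obtain ⟨N, u, hu, hN⟩ := exists_local d lam ((quot d lam).objPreimage A)
    have hiso : IsIso ((quot d lam).map u) := Localization.inverts (quot d lam) W u hu
    let e : (quot d lam).obj N ≅ A :=
      (asIso ((quot d lam).map u)).symm ≪≫ (quot d lam).objObjPreimageIso A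
    have hex : ∀ B : CostructuredArrow (quot d lam) A,
        ∃ f : B.left ⟶ N, (quot d lam).map f = B.hom ≫ e.inv := by
      intro B
      obtain ⟨φ, hφ⟩ := Localization.exists_rightFraction (quot d lam) W (B.hom ≫ e.inv)
      obtain ⟨g, hg⟩ := (hN φ.s φ.hs).2 φ.f
      have hs : IsIso ((quot d lam).map φ.s) := Localization.inverts (quot d lam) W _ φ.hs
      refine ⟨g, ?_⟩
      rw [hφ, ← cancel_epi ((quot d lam).map φ.s),
        MorphismProperty.RightFraction.map_s_comp_map, ← hg, Functor.map_comp]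
    have huniq : ∀ (B : EulerMod d lam) (f g : B ⟶ N),
        (quot d lam).map f = (quot d lam).map g → f = g := by
      intro B f g h
      obtain ⟨Z, s, hs, hsf⟩ := (MorphismProperty.map_eq_iff_precomp (quot d lam) W f g).1 h
      exact (hN s hs).1 hsf
    let T : CostructuredArrow (quot d lam) A := CostructuredArrow.mk e.hom
    have h1 : ∀ B, Nonempty (B ⟶ T) := fun B => by
      obtain ⟨f, hf⟩ := hex B
      exact ⟨CostructuredArrow.homMk f (by simp [T, hf])⟩
    have h2 : ∀ B, Subsingleton (B ⟶ T) := fun B => ⟨fun f g => by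
      apply CostructuredArrow.hom_ext
      apply huniq
      have hf := CostructuredArrow.w f
      have hg := CostructuredArrow.w g
      exact (cancel_mono e.hom).1 (hf.trans hg.symm)⟩
    exact hasTerminal_of_unique T
  exact isLeftAdjoint_of_costructuredArrowTerminals _

/-- The section functor `ω`, right adjoint to the quotient functor `π`. -/
def sectionFunctor : QCoh d lam ⥤ EulerMod d lam := (quot d lam).rightAdjoint

/-- The adjunction between the quotient functor and the section functor. -/
def quotAdjunction : quot d lam ⊣ sectionFunctor d lam := Adjunction.ofIsLeftAdjoint _

end SectionFunctor

/-! ### The global sections functor -/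

section GlobalSections

variable {K : Type u} [Field K] {n : ℕ} (d : Fin (n + 1) → ℕ+) (lam : K)

section

variable {M : Type*} [AddCommGroup M] [Module (Weyl K n) M]

/-- The action of `𝔻₀ / 𝔻₀ (E - λ)` on the `λ`-eigenspace of `E` induced by the action
of `𝔻₀`. -/
def twistedAction : TwistedOps d lam →+* AddMonoid.End (weightSpace d M lam) :=
  Ideal.Quotient.lift (eulerIdeal d lam)
    (Module.toAddMonoidEnd (weylZero K d) (weightSpace d M lam)) (by
      intro a ha
      obtain ⟨c, rfl⟩ := Submodule.mem_span_singleton.1 ha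
      refine AddMonoidHom.ext fun m => Subtype.ext ?_
      change ((c : Weyl K n) * (euler K d - algebraMap K (Weyl K n) lam)) • (m : M) = 0
      rw [mul_smul, sub_smul, mem_weightSpace.1 m.2, sub_self, smul_zero])

instance : Module (TwistedOps d lam) (weightSpace d M lam) :=
  Module.compHom _ (twistedAction (M := M) d lam)

lemma twistedOps_mk_smul (w : weylZero K d) (m : weightSpace d M lam) :
    (Ideal.Quotient.mk (eulerIdeal d lam) w) • m = w • m := rfl

end

/-- The functor `M ↦ M₀ = M^λ` from `𝔻`-modules to `𝔻₀ / 𝔻₀ (E - λ)`-modules. -/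
def degreeZero : ModuleCat.{u} (Weyl K n) ⥤ ModuleCat.{u} (TwistedOps d lam) where
  obj M := ModuleCat.of _ (weightSpace d M lam)
  map {M N} f := ModuleCat.ofHom
    { toFun m := ⟨f.hom m, by
        rw [mem_weightSpace, ← map_smul, mem_weightSpace.1 m.2, map_smul]⟩
      map_add' a b := Subtype.ext (map_add f.hom _ _)
      map_smul' w m := by
        obtain ⟨w, rfl⟩ := Ideal.Quotient.mk_surjective w
        exact Subtype.ext (map_smul f.hom w.1 m.1) }

variable [CharZero K]

/-- The global sections functor `Γ_λ`, `𝓜 ↦ ω(𝓜)₀`. -/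
def globalSections : QCoh d lam ⥤ ModuleCat.{u} (TwistedOps d lam) :=
  sectionFunctor d lam ⋙ (isEuler d lam).ι ⋙ degreeZero d lam

end GlobalSections

end WPS

end

noncomputable section

namespace WPS

/-! ### Eigenvectors of the Euler field: torsion, and the splitting off of the weight `λ` part. -/

section Algebra

variable {K : Type u} [Field K] {n : ℕ} (d : Fin (n + 1) → ℕ+)

section Modules

variable {M : Type*} [AddCommGroup M] [Module (Weyl K n) M]

/-! Everything is first done for the functor `M ↦ M₀` on `λ`-Euler modules, and then transported
through `π`.

The hypothesis on `λ` is used only to show that a torsion module has `M₀ = 0`. Multiplying a nonzero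
torsion eigenvector of weight `λ` by the variables, one reaches a nonzero vector killed by every
`xᵢ`. Its weight is `λ + a` with `a ∈ 𝒜`, but `E = ∑ dᵢ (∂ᵢ xᵢ - 1)` acts on it by `-∑ dᵢ`, which is
excluded (`eq_zero_of_isTorsionElt`). Since `M₀` is a direct summand of `M`, the functor `M ↦ M₀` is
exact. Hence it inverts the maps with torsion kernel and cokernel (`isIso_eulerDegreeZero_map`). The
unit `M → ωπM` is such a map, so `Γ_λ ∘ π` is `M ↦ M₀`, and exactness passes to `Γ_λ`.

For any `λ`, the functor `M ↦ M₀` has a right adjoint, which sends `N` to the Euler part of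
`Hom_{𝔻₀}(𝔻, N)`. Its counit is evaluation at `1` on the weight `λ` part, and this is bijective
because `𝔻₀` is a direct summand of `𝔻`. The adjunction descends along `π` to a right adjoint of
`Γ_λ` whose counit is again invertible. An exact functor with a fully faithful right adjoint is the
quotient by its kernel, which is the equivalence sought. -/

variable {d} in
lemma smul_mem_weightSpace {w : Weyl K n} {k : ℤ} (hw : w ∈ weylDegree K d k) {μ : K} {m : M}
    (hm : m ∈ weightSpace d M μ) : w • m ∈ weightSpace d M (μ + k) := by
  rw [mem_weightSpace] at hm ⊢
  rw [← mul_smul, euler_commute d hw, add_smul, mul_smul, hm, ← mul_smul, ← Algebra.commutes,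
    Algebra.smul_def, map_add, add_smul, mul_smul, mul_smul]

lemma x_mul_del (i : Fin (n + 1)) :
    (Weyl.x i * Weyl.del i : Weyl K n) = Weyl.del i * Weyl.x i - 1 := by
  have h := del_mul_poly (K := K) i (MvPolynomial.X i)
  rw [MvPolynomial.pderiv_X_self, map_one] at h
  exact eq_sub_of_add_eq h.symm

/-- Rewriting `xᵢ ∂ᵢ = ∂ᵢ xᵢ - 1` puts the `xᵢ` next to `m`. This is the source of the constant `-∑
dᵢ` in the hypothesis on `λ`. -/
lemma euler_smul_of_x_smul_eq_zero {m : M} (h : ∀ i, (Weyl.x i : Weyl K n) • m = 0) :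
    euler K d • m = algebraMap K (Weyl K n) (-∑ i, ((d i : ℕ) : K)) • m := by
  rw [euler, Finset.sum_smul, map_neg, map_sum, neg_smul, Finset.sum_smul,
    ← Finset.sum_neg_distrib]
  refine Finset.sum_congr rfl fun i _ => ?_
  rw [Algebra.smul_def, mul_smul, x_mul_del, sub_smul, mul_smul, h, smul_zero, one_smul, zero_sub,
    smul_neg]

/-- The Euler field has no torsion eigenvector of eigenvalue outside `-∑ᵢ dᵢ - 𝒜`. -/
lemma eq_zero_of_isTorsionElt {μ : K}
    (hμ : ∀ a ∈ AddSubmonoid.closure (Set.range fun i => ((d i : ℕ) : K)),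
      μ ≠ -(∑ i, ((d i : ℕ) : K)) - a)
    {m : M} (hm : m ∈ weightSpace d M μ) (ht : IsTorsionElt K d m) : m = 0 := by
  obtain ⟨N, hN⟩ := ht
  obtain ⟨k, hk⟩ : ∃ k : ℕ, N < k := ⟨N.toNat + 1, by have := Int.self_le_toNat N; omega⟩
  have hN' : ∀ l : ℤ, (k : ℤ) ≤ l → ∀ a ∈ polyDegree K d l, (polyToWeyl a : Weyl K n) • m = 0 :=
    fun l hl => hN l (lt_of_lt_of_le hk hl)
  clear hN hk
  -- Induction on a bound `k` such that `m` is killed by all degrees `≥ k`. For `k = 0` this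
  -- includes `1 ∈ 𝔸₀`. Passing to `xᵢ m` lowers the bound by `dᵢ ≥ 1` and raises the weight by
  -- `dᵢ`; the condition on `μ` survives because `𝒜` is stable under adding `dᵢ`.
  induction k generalizing m μ with
  | zero =>
    have h := hN' 0 le_rfl 1 (MvPolynomial.isWeightedHomogeneous_one _ _)
    rwa [map_one, one_smul] at h
  | succ k ih =>
    have hx : ∀ i, (Weyl.x i : Weyl K n) • m = 0 := by
      intro i
      refine ih (μ := μ + (((d i : ℕ) : ℤ) : K)) ?_
        (smul_mem_weightSpace (x_mem_weylDegree d i) hm) ?_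
      · intro a ha h
        refine hμ (a + ((d i : ℕ) : K))
          (add_mem ha (AddSubmonoid.subset_closure ⟨i, rfl⟩)) ?_
        rw [Int.cast_natCast] at h
        rw [← sub_sub, ← h, add_sub_cancel_right]
      · intro l hl a ha
        have hd : 1 ≤ (d i : ℕ) := (d i).pos
        rw [Weyl.x, ← mul_smul, ← map_mul]
        exact hN' (l + ((d i : ℕ) : ℤ)) (by push_cast; omega) _
          (MvPolynomial.IsWeightedHomogeneous.mul ha (MvPolynomial.isWeightedHomogeneous_X K _ i))
    have h := euler_smul_of_x_smul_eq_zero d hx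
    rw [mem_weightSpace.1 hm, ← sub_eq_zero, ← sub_smul, ← map_sub] at h
    -- The condition on `μ` at `a = 0`.
    have hc : μ - -∑ i, ((d i : ℕ) : K) ≠ 0 := by
      rw [sub_ne_zero]
      simpa using hμ 0 (zero_mem _)
    have h' := congrArg (algebraMap K (Weyl K n) (μ - -∑ i, ((d i : ℕ) : K))⁻¹ • ·) h
    simpa only [← mul_smul, ← map_mul, inv_mul_cancel₀ hc, map_one, one_smul, smul_zero] using h'

variable (M) in
/-- The sum of the eigenspaces `M^(λ + k)` of the Euler field with `k ≠ 0`. -/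
def weightSpaceCompl (lam : K) : Submodule (weylZero K d) M :=
  ⨆ (k : ℤ) (_ : k ≠ 0), weightSpace d M (lam + k)

lemma weightSpaceCompl_induction {lam : K} {p : M → Prop}
    (mem : ∀ k : ℤ, k ≠ 0 → ∀ m ∈ weightSpace d M (lam + k), p m) (zero : p 0)
    (add : ∀ a b, p a → p b → p (a + b)) {m : M} (hm : m ∈ weightSpaceCompl d M lam) : p m := by
  refine Submodule.iSup_induction _ (motive := p) hm (fun k x hx => ?_) zero add
  by_cases hk : k = 0
  · rw [iSup_neg (not_not.2 hk), Submodule.mem_bot] at hx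
    rwa [hx]
  · rw [iSup_pos hk] at hx
    exact mem k hk x hx

/-- A sum of eigenvectors of weights `λ + k`, `k ≠ 0`, is killed by a product of factors `E - λ - k`
with `k ≠ 0`. On weight `λ` such a product is the scalar `∏ (-k)`, nonzero in characteristic zero.
No Euler hypothesis on `M` is needed. -/
lemma disjoint_weightSpaceCompl [CharZero K] (lam : K) :
    Disjoint (weightSpace d M lam) (weightSpaceCompl d M lam) := by
  rw [Submodule.disjoint_def]
  intro m hm hm'
  obtain ⟨S, hS, h⟩ : ∃ S : Finset ℤ, 0 ∉ S ∧ eulerPoly d lam S • m = 0 := by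
    refine weightSpaceCompl_induction d (lam := lam)
      (p := fun m : M => ∃ S : Finset ℤ, 0 ∉ S ∧ eulerPoly d lam S • m = 0) (fun k hk m hm => ⟨{k}, ?_, ?_⟩)
      ⟨∅, Finset.notMem_empty _, smul_zero _⟩ ?_ hm'
    · simpa using hk.symm
    · rw [eulerPoly, aeval_euler_smul d _ hm]
      simp
    · rintro a b ⟨S, hS, ha⟩ ⟨T, hT, hb⟩
      refine ⟨S ∪ T, by simp [hS, hT], ?_⟩
      rw [smul_add, eulerPoly_smul_eq_zero_of_subset d Finset.subset_union_left ha,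
        eulerPoly_smul_eq_zero_of_subset d Finset.subset_union_right hb, add_zero]
  rw [eulerPoly, aeval_euler_smul d _ hm] at h
  set c := (∏ k ∈ S, (Polynomial.X - Polynomial.C (lam + k))).eval lam with hc
  have hc0 : c ≠ 0 := by
    rw [hc, Polynomial.eval_prod, Finset.prod_ne_zero_iff]
    intro k hk
    have : k ≠ 0 := fun h => hS (h ▸ hk)
    simpa using this
  have h' := congrArg (algebraMap K (Weyl K n) c⁻¹ • ·) h
  simpa only [← mul_smul, ← map_mul, inv_mul_cancel₀ hc0, map_one, one_smul, smul_zero] using h'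

lemma IsEulerModule.isCompl [CharZero K] {lam : K} (h : IsEulerModule d M lam) :
    IsCompl (weightSpace d M lam) (weightSpaceCompl d M lam) := by
  refine ⟨disjoint_weightSpaceCompl d lam, codisjoint_iff_le_sup.2 ?_⟩
  rw [← show _ = _ from h]
  refine iSup_le fun k => ?_
  by_cases hk : k = 0
  · rw [hk, Int.cast_zero, add_zero]
    exact le_sup_left
  · exact le_sup_of_le_right (le_iSup₂_of_le k hk le_rfl)

/-- The image of a `λ`-eigenvector under a surjection from a `λ`-Euler module has a preimage that
is a `λ`-eigenvector. -/
lemma exists_weightSpace_of_map_eq [CharZero K] {N : Type*} [AddCommGroup N] [Module (Weyl K n) N]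
    {lam : K} (h : IsEulerModule d M lam) (f : M →ₗ[Weyl K n] N) {m : M}
    (hm : f m ∈ weightSpace d N lam) : ∃ m' ∈ weightSpace d M lam, f m' = f m := by
  obtain ⟨a, ha, b, hb, rfl⟩ := Submodule.mem_sup.1
    ((h.isCompl d).sup_eq_top ▸ Submodule.mem_top (x := m))
  refine ⟨a, ha, ?_⟩
  have hfa : f a ∈ weightSpace d N lam := by
    rw [mem_weightSpace, ← map_smul, mem_weightSpace.1 ha, map_smul]
  have hfb : f b ∈ weightSpaceCompl d N lam := by
    refine weightSpaceCompl_induction d (p := fun b => f b ∈ weightSpaceCompl d N lam)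
      (fun k hk m hm => ?_) (by rw [map_zero]; exact zero_mem _)
      (fun a b ha hb => by rw [map_add]; exact add_mem ha hb) hb
    refine Submodule.mem_iSup_of_mem k (Submodule.mem_iSup_of_mem hk ?_)
    rw [mem_weightSpace, ← map_smul, mem_weightSpace.1 hm, map_smul]
  rw [map_add] at hm ⊢
  -- As `f b = f m - f a`, it has weight `λ`; it also lies in the sum of the other eigenspaces, so
  -- it vanishes.
  have hfb' : f b ∈ weightSpace d N lam := by
    simpa using sub_mem hm hfa
  rw [Submodule.disjoint_def.1 (disjoint_weightSpaceCompl d lam) _ hfb' hfb, add_zero]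

end Modules

/-! ### The degree zero part of the Weyl algebra is a direct summand -/

lemma one_mem_weylDegree : (1 : Weyl K n) ∈ weylDegree K d 0 := (weylZero K d).one_mem

lemma mul_mem_weylDegree {v w : Weyl K n} {k l : ℤ} (hv : v ∈ weylDegree K d k)
    (hw : w ∈ weylDegree K d l) : v * w ∈ weylDegree K d (k + l) := by
  intro j f hf
  have h := hv _ _ (hw j f hf)
  rwa [add_assoc, add_comm l] at h

/-- Degrees of operators are defined by their effect on polynomials, so this has to be proved: the
generators are homogeneous, and sums of homogeneous operators are stable under sums and products. -/
lemma iSup_weylDegree : ⨆ k, weylDegree K d k = (⊤ : Submodule K (Weyl K n)) := by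
  refine Submodule.eq_top_iff'.2 fun w => ?_
  induction w using Weyl.induction with
  | hx i => exact Submodule.mem_iSup_of_mem _ (x_mem_weylDegree d i)
  | hd i => exact Submodule.mem_iSup_of_mem _ (del_mem_weylDegree d i)
  | hc c => exact Submodule.mem_iSup_of_mem 0 ((weylZero K d).algebraMap_mem c)
  | hadd v w hv hw => exact add_mem hv hw
  | hmul v w hv hw =>
    refine Submodule.iSup_induction _ (motive := fun v => v * w ∈ _) hv (fun k v hv => ?_) ?_ ?_
    · refine Submodule.iSup_induction _ (motive := fun w => v * w ∈ _) hw (fun l w hw => ?_) ?_ ?_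
      · exact Submodule.mem_iSup_of_mem _ (mul_mem_weylDegree d hv hw)
      · rw [mul_zero]; exact zero_mem _
      · intro a b ha hb; rw [mul_add]; exact add_mem ha hb
    · rw [zero_mul]; exact zero_mem _
    · intro a b ha hb; rw [add_mul]; exact add_mem ha hb

variable (K) in
/-- `𝔻ₖ` as a left `𝔻₀`-submodule of `𝔻`. -/
def weylDegreeLeft (k : ℤ) : Submodule (weylZero K d) (Weyl K n) where
  carrier := weylDegree K d k
  zero_mem' := zero_mem _
  add_mem' := add_mem
  smul_mem' a w hw := by
    have h := mul_mem_weylDegree d (k := 0) a.2 hw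
    rwa [zero_add] at h

variable (K) in
/-- The sum of the `𝔻ₖ` with `k ≠ 0`. -/
def weylDegreeCompl : Submodule (weylZero K d) (Weyl K n) :=
  ⨆ (k : ℤ) (_ : k ≠ 0), weylDegreeLeft K d k

lemma weylDegreeCompl_induction {p : Weyl K n → Prop}
    (mem : ∀ k : ℤ, k ≠ 0 → ∀ w ∈ weylDegree K d k, p w) (zero : p 0)
    (add : ∀ a b, p a → p b → p (a + b)) {w : Weyl K n} (hw : w ∈ weylDegreeCompl K d) : p w := by
  refine Submodule.iSup_induction _ (motive := p) hw (fun k x hx => ?_) zero add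
  by_cases hk : k = 0
  · rw [iSup_neg (not_not.2 hk), Submodule.mem_bot] at hx
    rwa [hx]
  · rw [iSup_pos hk] at hx
    exact mem k hk x hx

/-- On a polynomial `f` of degree `j`, a sum of operators of nonzero degrees gives a result with no
component of degree `j`, while an operator of degree zero gives a result of degree `j` only. An
operator of both kinds therefore kills every monomial. -/
lemma isCompl_weylDegreeCompl : IsCompl (weylDegreeLeft K d 0) (weylDegreeCompl K d) := by
  constructor
  · rw [Submodule.disjoint_def]
    intro w hw hw'
    have key : ∀ j : ℤ, ∀ f ∈ polyDegree K d j,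
        MvPolynomial.weightedHomogeneousComponent (fun i => ((d i : ℕ) : ℤ)) j (Weyl.op w f) = 0 :=
      weylDegreeCompl_induction d (p := fun w => ∀ j : ℤ, ∀ f ∈ polyDegree K d j,
          MvPolynomial.weightedHomogeneousComponent (fun i => ((d i : ℕ) : ℤ)) j
            (Weyl.op w f) = 0)
        (fun k hk w hw j f hf =>
          (MvPolynomial.weightedHomogeneousComponent_of_mem (hw j f hf)).trans
            (if_neg (by omega)))
        (fun j f hf => by simp)
        (fun a b ha hb j f hf => by
          rw [map_add, LinearMap.add_apply, map_add, ha j f hf, hb j f hf, add_zero]) hw'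
    apply Weyl.ext'
    intro f
    induction f using MvPolynomial.induction_on' with
    | add p q hp hq => rw [map_add, map_add, hp, hq]
    | monomial m c =>
      have h := monomial_mem_polyDegree (K := K) d m c
      have h1 := hw _ _ h
      rw [add_zero] at h1
      rw [map_zero, LinearMap.zero_apply, ← key _ _ h]
      exact ((MvPolynomial.weightedHomogeneousComponent_of_mem h1).trans (if_pos rfl)).symm
  · refine codisjoint_iff_le_sup.2 fun w _ => ?_
    refine Submodule.iSup_induction (weylDegree K d)
      (motive := fun w => w ∈ weylDegreeLeft K d 0 ⊔ weylDegreeCompl K d)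
      (iSup_weylDegree (K := K) d ▸ Submodule.mem_top (x := w)) (fun k w hw => ?_) (zero_mem _)
      (fun _ _ => add_mem)
    by_cases hk : k = 0
    · subst hk
      exact Submodule.mem_sup_left hw
    · exact Submodule.mem_sup_right (Submodule.mem_iSup_of_mem k (Submodule.mem_iSup_of_mem hk hw))

variable (K) in
/-- The projection of `𝔻` to `𝔻₀` that kills the other degrees. -/
def weylProj : Weyl K n →ₗ[weylZero K d] weylZero K d where
  toFun v := ⟨_, (Submodule.projectionOnto _ _ (isCompl_weylDegreeCompl d) v).2⟩
  map_add' a b := Subtype.ext (congrArg Subtype.val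
    (map_add (Submodule.projectionOnto _ _ (isCompl_weylDegreeCompl d)) a b))
  map_smul' a v := Subtype.ext (congrArg Subtype.val
    (map_smul (Submodule.projectionOnto _ _ (isCompl_weylDegreeCompl d)) a v))

lemma weylProj_one : weylProj K d 1 = 1 :=
  Subtype.ext (congrArg Subtype.val (Submodule.projectionOnto_apply_left
    (isCompl_weylDegreeCompl d) ⟨1, one_mem_weylDegree d⟩))

lemma weylProj_eq_zero {v : Weyl K n} (hv : v ∈ weylDegreeCompl K d) : weylProj K d v = 0 := by
  rw [← Submodule.ker_projectionOnto (isCompl_weylDegreeCompl d)] at hv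
  exact Subtype.ext (congrArg Subtype.val (LinearMap.mem_ker.1 hv))

lemma sub_weylProj_mem (v : Weyl K n) : v - weylProj K d v ∈ weylDegreeCompl K d := by
  rw [← Submodule.ker_projectionOnto (isCompl_weylDegreeCompl d), LinearMap.mem_ker, map_sub]
  exact sub_eq_zero.2 (Submodule.projectionOnto_apply_left (isCompl_weylDegreeCompl d) _).symm

end Algebra

/-! ### Coinduction from degree zero -/

section Coinduction

variable {K : Type u} [Field K] {n : ℕ} (d : Fin (n + 1) → ℕ+) (lam : K)

section Module

variable (N : Type u) [AddCommGroup N] [Module (TwistedOps d lam) N]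

/-- The `𝔻₀`-linear maps from `𝔻` to a `𝔻₀ / 𝔻₀ (E - λ)`-module. -/
def Coind : Type u := Weyl K n →ₛₗ[Ideal.Quotient.mk (eulerIdeal d lam)] N

instance : AddCommGroup (Coind d lam N) :=
  inferInstanceAs (AddCommGroup (Weyl K n →ₛₗ[Ideal.Quotient.mk (eulerIdeal d lam)] N))

instance : FunLike (Coind d lam N) (Weyl K n) N :=
  inferInstanceAs (FunLike (Weyl K n →ₛₗ[Ideal.Quotient.mk (eulerIdeal d lam)] N) _ _)

instance : AddMonoidHomClass (Coind d lam N) (Weyl K n) N :=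
  inferInstanceAs (AddMonoidHomClass (Weyl K n →ₛₗ[Ideal.Quotient.mk (eulerIdeal d lam)] N) _ _)

variable {d lam N}

namespace Coind

lemma ext {f g : Coind d lam N} (h : ∀ v, f v = g v) : f = g := DFunLike.ext _ _ h

lemma map_mul (f : Coind d lam N) (a : weylZero K d) (v : Weyl K n) :
    f (a * v) = Ideal.Quotient.mk (eulerIdeal d lam) a • f v :=
  LinearMap.map_smulₛₗ (f : Weyl K n →ₛₗ[Ideal.Quotient.mk (eulerIdeal d lam)] N) a v

/-- The action of `𝔻` on `Coind` by right multiplication on the source. -/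
instance : Module (Weyl K n) (Coind d lam N) where
  smul w f := LinearMap.mk ⟨fun v => f (v * w), fun a b => by rw [add_mul, map_add]⟩ (fun a v => by
    change f ((a * v : Weyl K n) * w) = _
    rw [mul_assoc, map_mul])
  one_smul f := ext fun v => congrArg f (mul_one v)
  mul_smul a b f := ext fun v => congrArg f (mul_assoc v a b).symm
  smul_zero _ := rfl
  smul_add _ _ _ := rfl
  add_smul a b f := ext fun v => (congrArg f (mul_add v a b)).trans (map_add f _ _)
  zero_smul f := ext fun v => (congrArg f (mul_zero v)).trans (map_zero f)

lemma smul_apply (w : Weyl K n) (f : Coind d lam N) (v : Weyl K n) : (w • f) v = f (v * w) := rfl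

lemma add_apply (f g : Coind d lam N) (v : Weyl K n) : (f + g) v = f v + g v := rfl

lemma map_algebraMap_mul (f : Coind d lam N) (c : K) (v : Weyl K n) :
    f (algebraMap K _ c * v) =
      Ideal.Quotient.mk (eulerIdeal d lam) (algebraMap K _ c) • f v :=
  f.map_mul (algebraMap K (weylZero K d) c) v

lemma mk_eulerZero : Ideal.Quotient.mk (eulerIdeal d lam) (eulerZero K d) =
    Ideal.Quotient.mk (eulerIdeal d lam) (algebraMap K _ lam) :=
  Ideal.Quotient.eq.2 (Ideal.subset_span rfl)

/-- On the left of the argument, `E` counts as `λ` because `E - λ` acts as zero on `N`. The weight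
of `f` concerns `E` on the right of the argument, and comparing the two sides constrains `f`. -/
lemma map_euler_mul (f : Coind d lam N) (v : Weyl K n) :
    f (euler K d * v) = f (algebraMap K _ lam * v) := by
  rw [map_algebraMap_mul, ← mk_eulerZero]
  exact f.map_mul (eulerZero K d) v

lemma eq_zero_of_algebraMap_mul [CharZero K] (f : Coind d lam N) {k : ℤ} (hk : k ≠ 0)
    {v : Weyl K n} (h : f (algebraMap K _ (k : K) * v) = 0) : f v = 0 := by
  have h' := f.map_algebraMap_mul (k : K)⁻¹ (algebraMap K _ (k : K) * v)
  rwa [h, smul_zero, ← mul_assoc, ← RingHom.map_mul, inv_mul_cancel₀ (Int.cast_ne_zero.2 hk),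
    map_one, one_mul] at h'

/-- An element of `Coind` of weight `λ` vanishes outside degree zero. -/
lemma apply_eq_zero_of_mem_weylDegree [CharZero K] {f : Coind d lam N}
    (hf : f ∈ weightSpace d (Coind d lam N) lam) {k : ℤ} (hk : k ≠ 0) {v : Weyl K n}
    (hv : v ∈ weylDegree K d k) : f v = 0 := by
  have h1 : f (v * euler K d) = f (v * algebraMap K _ lam) :=
    congrArg (fun g : Coind d lam N => g v) hf
  -- With `v E = E v - k v`, the weight condition reads `f (λ v) - f (k v) = f (λ v)`.
  rw [eq_sub_of_add_eq (euler_commute d hv).symm, map_sub, map_euler_mul, ← Algebra.commutes,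
    Algebra.smul_def, sub_eq_self] at h1
  exact eq_zero_of_algebraMap_mul f hk h1

/-- An element of `Coind` of weight `λ + k`, `k ≠ 0`, vanishes at `1`. -/
lemma apply_one_eq_zero_of_mem_weightSpace [CharZero K] {k : ℤ} (hk : k ≠ 0) {f : Coind d lam N}
    (hf : f ∈ weightSpace d (Coind d lam N) (lam + k)) : f 1 = 0 := by
  have h1 : f (1 * euler K d) = f (1 * algebraMap K _ (lam + k)) :=
    congrArg (fun g : Coind d lam N => g 1) hf
  have h2 := f.map_euler_mul 1
  rw [one_mul, one_mul, map_add, map_add] at h1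
  rw [mul_one, mul_one] at h2
  -- The weight gives `f E = f (λ + k)` and linearity gives `f E = f λ`, so `f k = 0`.
  rw [h2, left_eq_add] at h1
  exact eq_zero_of_algebraMap_mul f hk (by rwa [mul_one])

/-- Since `f` vanishes on every `𝔻ₖ` with `k ≠ 0`, only the degree zero part of `v` matters, and
`𝔻₀`-linearity takes it out. Thus `f` is determined by `f 1`. -/
lemma apply_eq_apply_weylProj [CharZero K] {f : Coind d lam N}
    (hf : f ∈ weightSpace d (Coind d lam N) lam) (v : Weyl K n) :
    f v = Ideal.Quotient.mk (eulerIdeal d lam) (weylProj K d v) • f 1 := by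
  have h : f (v - weylProj K d v) = 0 :=
    weylDegreeCompl_induction d (p := fun v => f v = 0)
      (fun k hk w hw => apply_eq_zero_of_mem_weylDegree hf hk hw) (map_zero f)
      (fun a b ha hb => by rw [map_add, ha, hb, add_zero]) (sub_weylProj_mem d v)
  rw [map_sub, sub_eq_zero] at h
  rw [h]
  have h2 := f.map_mul (weylProj K d v) 1
  rwa [mul_one] at h2

variable (N) in
/-- Evaluation at `1` is a bijection from the elements of `Coind` of weight `λ`. -/
lemma bijective_apply_one [CharZero K] :
    Function.Bijective fun f : weightSpace d (Coind d lam N) lam => (f : Coind d lam N) 1 := by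
  constructor
  · rintro ⟨f, hf⟩ ⟨g, hg⟩ (hfg : f 1 = g 1)
    refine Subtype.ext (ext fun v => ?_)
    change f v = g v
    rw [apply_eq_apply_weylProj hf, apply_eq_apply_weylProj hg, hfg]
  · intro x
    -- The only possible preimage of `x`, by the previous formula.
    let f : Coind d lam N := LinearMap.mk
      ⟨fun v => Ideal.Quotient.mk (eulerIdeal d lam) (weylProj K d v) • x, fun a b => by
        rw [map_add, map_add, add_smul]⟩ (fun a v => by
        change Ideal.Quotient.mk (eulerIdeal d lam) (weylProj K d (a • v)) • x = _
        rw [map_smul, smul_eq_mul, RingHom.map_mul, mul_smul])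
    have hf0 : ∀ v ∈ weylDegreeCompl K d, f v = 0 := by
      intro v hv
      change Ideal.Quotient.mk (eulerIdeal d lam) (weylProj K d v) • x = 0
      rw [weylProj_eq_zero d hv, map_zero, zero_smul]
    have hf : f ∈ weightSpace d (Coind d lam N) lam := by
      refine ext fun v => ?_
      rw [smul_apply, smul_apply]
      have hmem : v ∈ weylDegreeLeft K d 0 ⊔ weylDegreeCompl K d :=
        (isCompl_weylDegreeCompl (K := K) d).sup_eq_top ▸ Submodule.mem_top
      obtain ⟨a, ha, b, hb, rfl⟩ := Submodule.mem_sup.1 hmem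
      -- The projection is only known to be left `𝔻₀`-linear, whereas the weight of `f` involves
      -- right multiplication by `E` and `λ`.
      have hbE : ∀ e ∈ weylZero K d, b * e ∈ weylDegreeCompl K d := by
        intro e he
        refine weylDegreeCompl_induction d (p := fun b => b * e ∈ weylDegreeCompl K d)
          (fun k hk w hw => ?_) (by rw [zero_mul]; exact zero_mem _)
          (fun a b ha hb => by rw [add_mul]; exact add_mem ha hb) hb
        refine Submodule.mem_iSup_of_mem k (Submodule.mem_iSup_of_mem hk ?_)
        have := mul_mem_weylDegree d hw (l := 0) he
        rwa [add_zero] at this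
      rw [add_mul, add_mul, map_add, map_add, hf0 _ (hbE _ (euler_mem_weylZero d)),
        hf0 _ (hbE _ ((weylZero K d).algebraMap_mem lam)), ← euler_commute_zero d ha,
        ← Algebra.commutes, map_euler_mul]
    refine ⟨⟨f, hf⟩, ?_⟩
    change Ideal.Quotient.mk (eulerIdeal d lam) (weylProj K d 1) • x = x
    rw [weylProj_one, map_one, one_smul]

end Coind

end Module

end Coinduction

/-! ### Coinduction as a right adjoint of the degree zero part. -/

section Coinduction

variable {K : Type u} [Field K] {n : ℕ} (d : Fin (n + 1) → ℕ+) (lam : K)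

section Hom

variable {M : Type*} [AddCommGroup M] [Module (Weyl K n) M]
  (N : Type u) [AddCommGroup N] [Module (TwistedOps d lam) N]

variable {N} in
/-- The map `M₀ → N` corresponding to a map from `M` to the coinduced module. -/
def Coind.evalOne (g : M →ₗ[Weyl K n] Coind d lam N) :
    weightSpace d M lam →ₗ[TwistedOps d lam] N where
  toFun m := g m 1
  map_add' a b := by
    rw [Submodule.coe_add, map_add]; rfl
  map_smul' a m := by
    obtain ⟨a, rfl⟩ := Ideal.Quotient.mk_surjective a
    rw [twistedOps_mk_smul, RingHom.id_apply, ← Coind.map_mul, mul_one]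
    change g ((a : Weyl K n) • (m : M)) 1 = _
    rw [map_smul, Coind.smul_apply, one_mul]

/-- Maps from a `λ`-Euler module `M` to the coinduced module correspond to maps `M₀ → N`. -/
lemma Coind.bijective_evalOne [CharZero K] (hM : IsEulerModule d M lam) :
    Function.Bijective (Coind.evalOne d lam : (M →ₗ[Weyl K n] Coind d lam N) → _) := by
  constructor
  · intro g g' h
    rw [← sub_eq_zero] at h ⊢
    -- On `M₀` this is the hypothesis. In the other weights it is automatic, since elements of
    -- `Coind` of weight `λ + k`, `k ≠ 0`, vanish at `1`.
    have h0 : ∀ m, (g - g') m 1 = 0 := by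
      intro m
      obtain ⟨a, ha, b, hb, rfl⟩ := Submodule.mem_sup.1
        ((hM.isCompl d).sup_eq_top ▸ Submodule.mem_top (x := m))
      rw [map_add, Coind.add_apply]
      have h1 : (g - g') a 1 = 0 := LinearMap.congr_fun h ⟨a, ha⟩
      have h2 : (g - g') b 1 = 0 := by
        refine weightSpaceCompl_induction d (p := fun b => (g - g') b 1 = 0)
          (fun k hk m hm => Coind.apply_one_eq_zero_of_mem_weightSpace hk ?_) ?_
          (fun a b ha hb => ?_) hb
        · rw [mem_weightSpace, ← map_smul, mem_weightSpace.1 hm, map_smul]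
        · rw [map_zero]; rfl
        · rw [map_add, Coind.add_apply, ha, hb, add_zero]
      rw [h1, h2, add_zero]
    refine LinearMap.ext fun m => Coind.ext fun v => ?_
    have h3 := h0 (v • m)
    rwa [map_smul, Coind.smul_apply, one_mul] at h3
  · intro h
    let p := Submodule.projectionOnto _ _ (hM.isCompl d)
    -- Forced by `g m v = (v • g m) 1 = g (v • m) 1`, which depends only on the weight `λ` component
    -- of `v • m`.
    let g₀ : M → Coind d lam N := fun m => LinearMap.mk
      ⟨fun v => h (p (v • m)), fun a b => by rw [add_smul, map_add, map_add]⟩ (fun a v => by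
        change h (p ((a * v : Weyl K n) • m)) = _
        rw [mul_smul]
        change h (p (a • (v • m))) = _
        rw [map_smul, ← twistedOps_mk_smul, map_smul])
    refine ⟨{ toFun := g₀, map_add' := fun a b => Coind.ext fun v => ?_,
              map_smul' := fun w m => Coind.ext fun v => ?_ }, LinearMap.ext fun m => ?_⟩
    · change h (p (v • (a + b))) = h (p (v • a)) + h (p (v • b))
      rw [smul_add, map_add, map_add]
    · change h (p (v • (w • m))) = h (p ((v * w) • m))
      rw [mul_smul]
    · change h (p ((1 : Weyl K n) • (m : M))) = h m
      rw [one_smul]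
      exact congrArg h (Submodule.projectionOnto_apply_left _ m)

end Hom

variable [CharZero K]

/-- The `λ`-Euler part of the coinduced module. -/
def coindEuler (N : ModuleCat.{u} (TwistedOps d lam)) : EulerMod d lam :=
  ⟨ModuleCat.of (Weyl K n) (eulerPart d (Coind d lam N) lam), by
    refine (isEulerModule_iff d).2 fun m => ?_
    obtain ⟨S, hS⟩ := (mem_eulerPart_iff d).1 m.2
    exact ⟨S, Subtype.ext hS⟩⟩

/-- The degree zero part of a `λ`-Euler module. -/
abbrev eulerDegreeZero : EulerMod d lam ⥤ ModuleCat.{u} (TwistedOps d lam) :=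
  (isEuler d lam).ι ⋙ degreeZero d lam

variable {d lam} in
/-- The map `M₀ → N` corresponding to a map from `M` to `coindEuler N`. -/
def coindEulerEval {M : EulerMod d lam} {N : ModuleCat.{u} (TwistedOps d lam)}
    (g : M ⟶ coindEuler d lam N) : (eulerDegreeZero d lam).obj M ⟶ N :=
  ModuleCat.ofHom (Coind.evalOne d lam ((eulerPart d (Coind d lam N) lam).subtype ∘ₗ g.hom.hom))

/-- A linear map carries a polynomial in `E` killing `m` to one killing its image. Maps from an
Euler module to `Coind` thus land in its Euler part, and restricting to that part loses nothing. -/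
lemma bijective_coindEulerEval (M : EulerMod d lam) (N : ModuleCat.{u} (TwistedOps d lam)) :
    Function.Bijective (coindEulerEval : (M ⟶ coindEuler d lam N) → _) := by
  have hb := Coind.bijective_evalOne d lam (M := M.obj) N M.property
  constructor
  · intro g g' h
    have h' := hb.1 (ModuleCat.hom_ext_iff.1 h)
    refine ObjectProperty.hom_ext _ (ModuleCat.hom_ext (LinearMap.ext fun m => Subtype.ext ?_))
    exact LinearMap.congr_fun h' m
  · intro h
    obtain ⟨g, hg⟩ := hb.2 h.hom
    have key : ∀ m, g m ∈ eulerPart d (Coind d lam N) lam := by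
      intro m
      obtain ⟨S, hS⟩ := (isEulerModule_iff d).1 M.property m
      exact (mem_eulerPart_iff d).2 ⟨S, by rw [← map_smul, hS, map_zero]⟩
    exact ⟨ObjectProperty.homMk (ModuleCat.ofHom (g.codRestrict _ key)), ModuleCat.hom_ext hg⟩

/-- The bijection that exhibits `coindEuler` as a right adjoint of the degree zero part. -/
def coindEulerEquiv (M : EulerMod d lam) (N : ModuleCat.{u} (TwistedOps d lam)) :
    ((eulerDegreeZero d lam).obj M ⟶ N) ≃ (M ⟶ coindEuler d lam N) :=
  (Equiv.ofBijective _ (bijective_coindEulerEval d lam M N)).symm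

lemma coindEulerEquiv_naturality {M' M : EulerMod d lam} {N : ModuleCat.{u} (TwistedOps d lam)}
    (f : M' ⟶ M) (g : (eulerDegreeZero d lam).obj M ⟶ N) :
    coindEulerEquiv d lam M' N ((eulerDegreeZero d lam).map f ≫ g) =
      f ≫ coindEulerEquiv d lam M N g := by
  refine (Equiv.symm_apply_eq _).2 ?_
  obtain ⟨g, rfl⟩ := (coindEulerEquiv d lam M N).symm.surjective g
  rw [Equiv.apply_symm_apply]
  rfl

/-- The coinduction functor from `𝔻₀ / 𝔻₀ (E - λ)`-modules to `λ`-Euler modules. -/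
def coinduction : ModuleCat.{u} (TwistedOps d lam) ⥤ EulerMod d lam :=
  Adjunction.rightAdjointOfEquiv (coindEulerEquiv d lam)
    fun _ _ _ => coindEulerEquiv_naturality d lam

/-- Coinduction is right adjoint to the degree zero part. -/
def coinductionAdjunction : eulerDegreeZero d lam ⊣ coinduction d lam :=
  Adjunction.adjunctionOfEquivRight (coindEulerEquiv d lam)
    fun _ _ _ => coindEulerEquiv_naturality d lam

/-- The counit is evaluation at `1` on the elements of weight `λ`, and these all lie in the Euler
part as its summand `k = 0`. -/
instance : IsIso (coinductionAdjunction d lam).counit := by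
  have : ∀ N, IsIso ((coinductionAdjunction d lam).counit.app N) := by
    intro N
    rw [ConcreteCategory.isIso_iff_bijective]
    have h : ∀ f, (coinductionAdjunction d lam).counit.app N f = (f.1.1 : Coind d lam N) 1 :=
      fun f => by
        rw [coinductionAdjunction, Adjunction.adjunctionOfEquivRight_counit_app]
        rfl
    constructor
    · intro f g hfg
      rw [h, h] at hfg
      have hfg' := (Coind.bijective_apply_one N).1 (a₁ := ⟨f.1.1, congrArg Subtype.val f.2⟩)
        (a₂ := ⟨g.1.1, congrArg Subtype.val g.2⟩) hfg
      exact Subtype.ext (Subtype.ext (congrArg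
        (fun x : weightSpace d (Coind d lam N) lam => (x : Coind d lam N)) hfg'))
    · intro x
      obtain ⟨f, hf⟩ := (Coind.bijective_apply_one (d := d) (lam := lam) N).2 x
      refine ⟨⟨⟨f.1, ?_⟩, Subtype.ext f.2⟩, (h _).trans hf⟩
      exact Submodule.mem_iSup_of_mem (p := fun k : ℤ => weightSpace d (Coind d lam N) (lam + k)) 0
        (by simp)
  exact NatIso.isIso_of_isIso_app _

end Coinduction

/-! ### Exactness of the degree zero part -/

section Exactness

variable {K : Type u} [Field K] {n : ℕ} (d : Fin (n + 1) → ℕ+) (lam : K)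

instance : (degreeZero d lam).Additive where
  map_add := rfl

variable [CharZero K]

/-- Exactness on the left holds for any eigenspace, a preimage under an injective map of an
eigenvector being an eigenvector. Exactness on the right uses the weight decomposition of the middle
term to correct a preimage. -/
lemma eulerDegreeZero_map_shortExact (S : ShortComplex (EulerMod d lam)) (hS : S.ShortExact) :
    (S.map (eulerDegreeZero d lam)).ShortExact := by
  have hT := hS.map_of_exact (isEuler d lam).ι
  have hf : Function.Injective S.f.hom.hom := hT.moduleCat_injective_f
  have hg : Function.Surjective S.g.hom.hom := hT.moduleCat_surjective_g
  have he : ∀ x, S.g.hom.hom x = 0 → ∃ y, S.f.hom.hom y = x :=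
    (ShortComplex.moduleCat_exact_iff _).1 hT.exact
  refine { exact := (ShortComplex.moduleCat_exact_iff _).2 fun x hx => ?_, mono_f := ?_,
           epi_g := ?_ }
  · obtain ⟨y, hy⟩ := he x.1 (congrArg Subtype.val hx)
    refine ⟨⟨y, hf ?_⟩, Subtype.ext hy⟩
    rw [map_smul, map_smul, hy]
    exact x.2
  · refine (ModuleCat.mono_iff_injective _).2 fun a b hab => Subtype.ext (hf ?_)
    exact congrArg Subtype.val hab
  · refine (ModuleCat.epi_iff_surjective _).2 fun y => ?_
    obtain ⟨x, hx⟩ := hg y.1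
    obtain ⟨x', hx', h⟩ := exists_weightSpace_of_map_eq d S.X₂.property S.g.hom.hom (m := x)
      (hx ▸ y.2)
    exact ⟨⟨x', hx'⟩, Subtype.ext (h.trans hx)⟩

lemma eulerDegreeZero_exact : PreservesFiniteLimits (eulerDegreeZero d lam) ∧
    PreservesFiniteColimits (eulerDegreeZero d lam) :=
  ((eulerDegreeZero d lam).exact_tfae.out 0 3).1 (eulerDegreeZero_map_shortExact d lam)

/-- The degree zero part does not see torsion. -/
lemma isIso_eulerDegreeZero_map
    (hlam : ∀ a ∈ AddSubmonoid.closure (Set.range fun i => ((d i : ℕ) : K)),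
      lam ≠ -(∑ i, ((d i : ℕ) : K)) - a)
    {X Y : EulerMod d lam} {f : X ⟶ Y} (hf : (isTorsionEuler d lam).isoModSerre f) :
    IsIso ((eulerDegreeZero d lam).map f) := by
  rw [isoModSerre_iff] at hf
  rw [ConcreteCategory.isIso_iff_bijective]
  constructor
  · intro a b hab
    have hab' : f.hom.hom a.1 = f.hom.hom b.1 := congrArg Subtype.val hab
    rw [← sub_eq_zero, ← map_sub] at hab'
    exact Subtype.ext (sub_eq_zero.1
      (eq_zero_of_isTorsionElt d hlam (sub_mem a.2 b.2) (hf.1 _ hab')))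
  · intro y
    -- The class of `y` in the cokernel is torsion of weight `λ`, hence zero. A preimage of `y` is
    -- then replaced by one of weight `λ`.
    have hy := (torsionMod_iff d _ _).1 (hf.2 y.1)
    have hy0 := eq_zero_of_isTorsionElt d hlam (by
      rw [mem_weightSpace, ← map_smul, mem_weightSpace.1 y.2, map_smul]) hy
    rw [Submodule.mkQ_apply, Submodule.Quotient.mk_eq_zero] at hy0
    obtain ⟨x, hx⟩ := hy0
    obtain ⟨x', hx', h⟩ := exists_weightSpace_of_map_eq d X.property f.hom.hom (m := x)
      (hx ▸ y.2)
    exact ⟨⟨x', hx'⟩, Subtype.ext (h.trans hx)⟩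

end Exactness

/-! ### The global sections functor -/

section

variable {C D : Type*} [Category* C] [Category* D] {L : C ⥤ D} {R : D ⥤ C}

/-- The right adjoint of a localization functor is fully faithful. -/
lemma isIso_counit_of_isLocalization (W : MorphismProperty C) [L.IsLocalization W]
    (adj : L ⊣ R) : IsIso adj.counit := by
  -- Precomposition with `L` is fully faithful and right adjoint to precomposition with `R`, so the
  -- counit of that adjunction is invertible. Its value at the identity functor is the counit of
  -- `adj`.
  have := Localization.full_whiskeringLeft L W D
  have := Localization.faithful_whiskeringLeft L W D
  have h : IsIso (((adj.whiskerLeft D).counit).app (𝟭 D)) := inferInstance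
  have : ∀ Y, IsIso (adj.counit.app Y) := by
    intro Y
    have hY : IsIso ((((adj.whiskerLeft D).counit).app (𝟭 D)).app Y) := inferInstance
    simpa using hY
  exact NatIso.isIso_of_isIso_app _

end

section GlobalSections

variable {K : Type u} [Field K] [CharZero K] {n : ℕ} (d : Fin (n + 1) → ℕ+) (lam : K)

/-- By a triangle identity, `π` of the unit is inverse to an invertible counit. The maps that `π`
inverts are exactly those with torsion kernel and cokernel. -/
lemma isoModSerre_quotAdjunction_unit (M : EulerMod d lam) :
    (isTorsionEuler d lam).isoModSerre ((quotAdjunction d lam).unit.app M) := by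
  have := isIso_counit_of_isLocalization (isTorsionEuler d lam).isoModSerre (quotAdjunction d lam)
  rw [← ObjectProperty.SerreClassLocalization.isIso_map_iff (quot d lam) (isTorsionEuler d lam)]
  exact isIso_of_comp_hom_eq_id _ ((quotAdjunction d lam).left_triangle_components M)

variable (hlam : ∀ a ∈ AddSubmonoid.closure (Set.range fun i => ((d i : ℕ) : K)),
  lam ≠ -(∑ i, ((d i : ℕ) : K)) - a)

/-- The global sections of the twisted D-module associated with `M` are `M₀`. -/
def quotCompGlobalSections : quot d lam ⋙ globalSections d lam ≅ eulerDegreeZero d lam :=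
  (NatIso.ofComponents (F := eulerDegreeZero d lam) (G := quot d lam ⋙ globalSections d lam)
    (fun M =>
    have := isIso_eulerDegreeZero_map d lam hlam (isoModSerre_quotAdjunction_unit d lam M)
    @asIso _ _ ((eulerDegreeZero d lam).obj M) ((quot d lam ⋙ globalSections d lam).obj M)
      ((eulerDegreeZero d lam).map ((quotAdjunction d lam).unit.app M)) this)
    (fun f => by
      have h := congrArg (eulerDegreeZero d lam).map ((quotAdjunction d lam).unit.naturality f)
      rw [Functor.map_comp, Functor.map_comp] at h
      exact h)).symm

include hlam

/-- Exactness of a functor on a Serre quotient can be tested after composing with `π`, where it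
becomes exactness of `M ↦ M₀`. -/
lemma globalSections_exact : PreservesFiniteLimits (globalSections d lam) ∧
    PreservesFiniteColimits (globalSections d lam) := by
  obtain ⟨_, _⟩ := eulerDegreeZero_exact d lam
  rw [← ObjectProperty.SerreClassLocalization.preservesFiniteLimits_comp_iff (quot d lam)
      (isTorsionEuler d lam),
    ← ObjectProperty.SerreClassLocalization.preservesFiniteColimits_comp_iff (quot d lam)
      (isTorsionEuler d lam)]
  exact ⟨preservesFiniteLimits_of_natIso (quotCompGlobalSections d lam hlam).symm,
    preservesFiniteColimits_of_natIso (quotCompGlobalSections d lam hlam).symm⟩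

/-- The adjunction between `M ↦ M₀` and coinduction descends along `π`. The target category is left
unchanged: it is viewed as its own localization at isomorphisms. -/
lemma exists_globalSections_adjunction :
    ∃ adj : globalSections d lam ⊣ coinduction d lam ⋙ quot d lam, IsIso adj.counit := by
  let : CatCommSq (eulerDegreeZero d lam) (quot d lam) (𝟭 _) (globalSections d lam) :=
    ⟨Functor.rightUnitor _ ≪≫ (quotCompGlobalSections d lam hlam).symm⟩
  let : CatCommSq (coinduction d lam) (𝟭 _) (quot d lam) (coinduction d lam ⋙ quot d lam) :=
    ⟨(Functor.leftUnitor _).symm⟩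
  let adj := (coinductionAdjunction d lam).localization (quot d lam)
    (isTorsionEuler d lam).isoModSerre (𝟭 _) (MorphismProperty.isomorphisms _)
    (globalSections d lam) (coinduction d lam ⋙ quot d lam)
  refine ⟨adj, ?_⟩
  have : ∀ N, IsIso (adj.counit.app N) := by
    intro N
    have h : adj.counit.app ((𝟭 _).obj N) = _ := Adjunction.localization_counit_app ..
    change IsIso (adj.counit.app ((𝟭 _).obj N))
    -- The formula writes the counit as a composite of comparison isomorphisms with the invertible
    -- counit of `coinductionAdjunction`.
    rw [h]
    infer_instance
  exact NatIso.isIso_of_isIso_app _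

end GlobalSections

end WPS

end

theorem mainTheorem2 {K : Type u} [Field K] [CharZero K]
    (n : ℕ) (hn : 1 ≤ n) (d : Fin (n + 1) → ℕ+) (lam : K)
    (hlam : ∀ a ∈ AddSubmonoid.closure (Set.range fun i => ((d i : ℕ) : K)),
      lam ≠ -(∑ i, ((d i : ℕ) : K)) - a) :
    ∃ (_ : PreservesFiniteLimits (WPS.globalSections d lam))
      (_ : PreservesFiniteColimits (WPS.globalSections d lam))
      (F : (WPS.globalSections d lam).kernel.isoModSerre.Localization ⥤
        ModuleCat.{u} (WPS.TwistedOps d lam)),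
      Nonempty ((WPS.globalSections d lam).kernel.isoModSerre.Q ⋙ F ≅ WPS.globalSections d lam) ∧
        F.IsEquivalence := by
  obtain ⟨h₁, h₂⟩ := WPS.globalSections_exact d lam hlam
  obtain ⟨adj, hadj⟩ := WPS.exists_globalSections_adjunction d lam hlam
  have := adj.fullyFaithfulROfIsIsoCounit.full
  have := adj.fullyFaithfulROfIsIsoCounit.faithful
  -- An exact functor with a fully faithful right adjoint is a localization at the maps whose kernel
  -- and cokernel it kills. `F` then compares two localizations at the same class of maps.
  have := Abelian.isLocalization_isoModSerre_kernel_of_leftAdjoint adj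
  exact ⟨h₁, h₂, _, ⟨Localization.qCompEquivalenceFromModelFunctorIso (WPS.globalSections d lam) _⟩,
    inferInstance⟩
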